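/- Let $\mathbb K=\mathbb R$ or $\mathbb C$, let $E$ be a locally convex Hausdorff space over $\mathbb K$ whose topology is generated by a family of seminorms $(p_\alpha)_{\alpha\in\mathfrak A}$, and let $\Omega$ be a locally compact Hausdorff space. Let $\mathcal V^0=(\nu_j)_{j\in J}$ be a directed family of weights on $\Omega$, that is, $\nu_j\colon\Omega\to[0,\infty)$, for all $j_1,j_2\in J$ there are $j_3\in J$ and $C>0$ with $\nu_{j_1}\le C\nu_{j_3}$ and $\nu_{j_2}\le C\nu_{j_3}$, and for every $x\in\Omega$ there is $j\in J$ with $\nu_j(x)>0$. Suppose that $\mathcal V^0$ is locally bounded ($\sup_{K}\nu_j<\infty$ for every compact $K\subset\Omega$ and every $j\in J$) and locally bounded away from zero (for every compact $K\subset\Omega$ there is $j\in J$ with $\inf_{K}\nu_j>0$). For $f\colon\Omega\to E$ and $S\subset\Omega$ put $|f|_{S,j,\alpha}:=\sup_{x\in S}p_\alpha(f(x))\nu_j(x)$ and $|f|_{j,\alpha}:=|f|_{\Omega,j,\alpha}$. Let $\mathcal{CV}^0_0(\Omega,E)$ be the space of all continuous $f\colon\Omega\to E$ such that for all $j\in J$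 and $\alpha\in\mathfrak A$ we have $|f|_{j,\alpha}<\infty$ and for every $\varepsilon>0$ there is a compact $K\subset\Omega$ with $|f|_{\Omega\setminus K,j,\alpha}<\varepsilon$, equipped with the seminorms $|\cdot|_{j,\alpha}$. Write $\mathcal{CV}^0_0(\Omega):=\mathcal{CV}^0_0(\Omega,\mathbb K)$, where $\mathbb K$ carries the single seminorm $|\cdot|$. Let $\mathcal C^0_c(\Omega,E)$ be the space of continuous functions $\Omega\to E$ with compact support, $\mathcal C^0_c(\Omega):=\mathcal C^0_c(\Omega,\mathbb K)$, and regard $\sum_n\varphi_n\otimes e_n\in\mathcal C^0_c(\Omega)\otimes E$ as the function $x\mapsto\sum_n\varphi_n(x)e_n$. For locally convex Hausdorff spaces $F$ and $E$ let $F'_\kappa$ be the dual of $F$ with the topology of uniform convergence on the absolutely convex compact subsets of $F$, and let $F\varepsilon E$ be the space of continuous linear maps $F'_\kappa\to E$ with the topology of uniform convergence on the equicontinuous subsets of $F'$. Let $F\otimes_\varepsilon E$ be $F\otimes E$ with the topology induced by $\Theta\colon F\otimes E\to F\varepsilon E$, $\sum_n f_n\otimes e_n\mapsto[y\mapsto\sum_n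 y(f_n)e_n]$, and $F\widehat\otimes_\varepsilon E$ its completion. Then the following statements hold. (a) $\mathcal C^0_c(\Omega)\otimes E$ is contained and dense in $\mathcal{CV}^0_0(\Omega,E)$. (b) For every $f\in\mathcal C^0_c(\Omega,E)$, every open neighbourhood $V$ of $\operatorname{supp}f$, every $\varepsilon>0$, $j\in J$ and $\alpha\in\mathfrak A$ there is $g\in\mathcal C^0_c(\Omega)\otimes E$ such that $\operatorname{supp}g\subset V$ and $|f-g|_{j,\alpha}\le\varepsilon$. (c) If $E$ is complete, then \[ \mathcal{CV}^0_0(\Omega,E)\cong\mathcal{CV}^0_0(\Omega)\,\varepsilon\, E\cong\mathcal{CV}^0_0(\Omega)\,\widehat\otimes_\varepsilon E \] as topological vector spaces, the first isomorphism being inverse to $u\mapsto[x\mapsto u(\delta_x)]$, where $\delta_x(f)=f(x)$, and the second one mapping $\Theta(t)$ to $t$ for every $t\in\mathcal{CV}^0_0(\Omega)\otimes E$. (d) $\mathcal{CV}^0_0(\Omega)$ has the approximation property: the identity of $X:=\mathcal{CV}^0_0(\Omega)$ lies in the closure of the continuous linear operators $X\to X$ of finite rank, in the space of continuous linear operators $X\to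 X$ with the topology of uniform convergence on the absolutely convex compact subsets of $X$. -/

import Mathlib

open scoped ENNReal NNReal TensorProduct CompactlySupported

noncomputable section

/-! ### Weighted spaces of continuous functions -/

/-- `sup_{x ∈ S} q(f(x)) w(x)`, with values in `[0, ∞]`. -/
def weightedSup {𝕜 Ω E : Type*} [RCLike 𝕜] [AddCommGroup E] [Module 𝕜 E]
    (q : Seminorm 𝕜 E) (w : Ω → ℝ≥0) (S : Set Ω) (f : Ω → E) : ℝ≥0∞ :=
  ⨆ x ∈ S, ENNReal.ofReal (q (f x)) * (w x : ℝ≥0∞)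

section weightedSup

variable {𝕜 Ω E : Type*} [RCLike 𝕜] [AddCommGroup E] [Module 𝕜 E]
  (q : Seminorm 𝕜 E) (w : Ω → ℝ≥0) (S : Set Ω)

theorem weightedSup_le_iff {f : Ω → E} {C : ℝ≥0∞} :
    weightedSup q w S f ≤ C ↔ ∀ x ∈ S, ENNReal.ofReal (q (f x)) * (w x : ℝ≥0∞) ≤ C := by
  simp [weightedSup]

theorem le_weightedSup (f : Ω → E) {x : Ω} (hx : x ∈ S) :
    ENNReal.ofReal (q (f x)) * (w x : ℝ≥0∞) ≤ weightedSup q w S f :=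
  (weightedSup_le_iff q w S).1 le_rfl x hx

theorem weightedSup_mono {S T : Set Ω} (h : S ⊆ T) (f : Ω → E) :
    weightedSup q w S f ≤ weightedSup q w T f :=
  (weightedSup_le_iff q w S).2 fun _ hx => le_weightedSup q w T f (h hx)

theorem weightedSup_zero : weightedSup q w S (0 : Ω → E) = 0 := by
  simp [weightedSup]

theorem weightedSup_add_le (f g : Ω → E) :
    weightedSup q w S (f + g) ≤ weightedSup q w S f + weightedSup q w S g := by
  refine (weightedSup_le_iff q w S).2 fun x hx => ?_
  calc ENNReal.ofReal (q ((f + g) x)) * (w x : ℝ≥0∞)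
      ≤ (ENNReal.ofReal (q (f x)) + ENNReal.ofReal (q (g x))) * (w x : ℝ≥0∞) := by
        gcongr
        rw [← ENNReal.ofReal_add (apply_nonneg q _) (apply_nonneg q _)]
        exact ENNReal.ofReal_le_ofReal (map_add_le_add q _ _)
    _ ≤ _ := by
        rw [add_mul]
        exact add_le_add (le_weightedSup q w S f hx) (le_weightedSup q w S g hx)

theorem weightedSup_smul (c : 𝕜) (f : Ω → E) :
    weightedSup q w S (c • f) = ENNReal.ofReal ‖c‖ * weightedSup q w S f := by
  simp only [weightedSup, ENNReal.mul_iSup]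
  refine iSup_congr fun x => iSup_congr fun _ => ?_
  rw [Pi.smul_apply, map_smul_eq_mul, ENNReal.ofReal_mul (norm_nonneg c), mul_assoc]

end weightedSup

/-- A directed family of weights `ν_j : Ω → [0, ∞)`, `j ∈ J` (the case `k = 0`). -/
structure IsWeightFamily {Ω J : Type*} (ν : J → Ω → ℝ≥0) : Prop where
  directed : ∀ j₁ j₂ : J, ∃ j₃ : J, ∃ C : ℝ≥0, 0 < C ∧
    (∀ x, ν j₁ x ≤ C * ν j₃ x) ∧ (∀ x, ν j₂ x ≤ C * ν j₃ x)
  pos : ∀ x : Ω, ∃ j : J, 0 < ν j x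

/-- `sup_K ν_j < ∞` for every compact `K` and every `j`. -/
def IsLocallyBoundedFamily {Ω J : Type*} [TopologicalSpace Ω] (ν : J → Ω → ℝ≥0) : Prop :=
  ∀ K : Set Ω, IsCompact K → ∀ j : J, ∃ C : ℝ≥0, ∀ x ∈ K, ν j x ≤ C

/-- For every compact `K` there is `j` with `inf_K ν_j > 0`. -/
def IsLocallyBoundedAwayFromZero {Ω J : Type*} [TopologicalSpace Ω] (ν : J → Ω → ℝ≥0) : Prop :=
  ∀ K : Set Ω, IsCompact K → ∃ j : J, ∃ c : ℝ≥0, 0 < c ∧ ∀ x ∈ K, c ≤ ν j x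

section WeightedSpace

variable {𝕜 Ω E J A : Type*} [RCLike 𝕜] [TopologicalSpace Ω]
  [AddCommGroup E] [Module 𝕜 E] [TopologicalSpace E] [IsTopologicalAddGroup E]
  [ContinuousSMul 𝕜 E]

/-- The linear space underlying `CV⁰(Ω, E)`: the continuous functions `f` with
`sup_Ω p_α(f) ν_j < ∞` for all `j`, `α`. -/
def weightedSubmodule (ν : J → Ω → ℝ≥0) (p : SeminormFamily 𝕜 E A) : Submodule 𝕜 C(Ω, E) where
  carrier := {f | ∀ j α, weightedSup (p α) (ν j) Set.univ f < ∞}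
  zero_mem' := fun j α => by
    rw [ContinuousMap.coe_zero, weightedSup_zero]
    exact ENNReal.zero_lt_top
  add_mem' := fun {f g} hf hg j α =>
    (weightedSup_add_le (p α) (ν j) Set.univ f g).trans_lt
      (ENNReal.add_lt_top.2 ⟨hf j α, hg j α⟩)
  smul_mem' := fun c f hf j α => by
    rw [ContinuousMap.coe_smul, weightedSup_smul]
    exact ENNReal.mul_lt_top ENNReal.ofReal_lt_top (hf j α)

/-- The linear space underlying `CV⁰₀(Ω, E)`: the functions in `CV⁰(Ω, E)` that vanish at infinity
when weighted. -/
def weightedSubmodule₀ [T2Space Ω] (ν : J → Ω → ℝ≥0) (p : SeminormFamily 𝕜 E A) :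
    Submodule 𝕜 C(Ω, E) where
  carrier := {f | f ∈ weightedSubmodule ν p ∧ ∀ j α, ∀ ε : ℝ≥0∞, 0 < ε →
    ∃ K : Set Ω, IsCompact K ∧ weightedSup (p α) (ν j) Kᶜ f < ε}
  zero_mem' := ⟨zero_mem _, fun j α ε hε => ⟨∅, isCompact_empty, by
    rw [ContinuousMap.coe_zero, weightedSup_zero]
    exact hε⟩⟩
  add_mem' := fun {f g} hf hg => ⟨add_mem hf.1 hg.1, fun j α ε hε => by
    obtain ⟨K, hK, hfK⟩ := hf.2 j α (ε / 2) (ENNReal.half_pos hε.ne')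
    obtain ⟨L, hL, hgL⟩ := hg.2 j α (ε / 2) (ENNReal.half_pos hε.ne')
    refine ⟨K ∪ L, hK.union hL, ?_⟩
    calc weightedSup (p α) (ν j) (K ∪ L)ᶜ (f + g)
        ≤ weightedSup (p α) (ν j) (K ∪ L)ᶜ f + weightedSup (p α) (ν j) (K ∪ L)ᶜ g :=
          weightedSup_add_le _ _ _ _ _
      _ ≤ weightedSup (p α) (ν j) Kᶜ f + weightedSup (p α) (ν j) Lᶜ g :=
          add_le_add
            (weightedSup_mono _ _ (Set.compl_subset_compl.2 Set.subset_union_left) _)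
            (weightedSup_mono _ _ (Set.compl_subset_compl.2 Set.subset_union_right) _)
      _ < ε / 2 + ε / 2 := ENNReal.add_lt_add hfK hgL
      _ = ε := ENNReal.add_halves ε⟩
  smul_mem' := fun c f hf => ⟨Submodule.smul_mem _ c hf.1, fun j α ε hε => by
    obtain ⟨K, hK, hfK⟩ := hf.2 j α (ε / (ENNReal.ofReal ‖c‖ + 1))
      (ENNReal.div_pos hε.ne' (by simp))
    refine ⟨K, hK, ?_⟩
    rw [ContinuousMap.coe_smul, weightedSup_smul]
    calc ENNReal.ofReal ‖c‖ * weightedSup (p α) (ν j) Kᶜ f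
        ≤ (ENNReal.ofReal ‖c‖ + 1) * weightedSup (p α) (ν j) Kᶜ f := by gcongr; exact le_self_add
      _ < ε := by
        rw [mul_comm]
        exact ENNReal.mul_lt_of_lt_div hfK⟩

/-- The space `CV⁰₀(Ω, E)`. As a type of its own it does not inherit the compact-open topology of
`C(Ω, E)`; its topology is the weighted one defined below. -/
def CVZero [T2Space Ω] (ν : J → Ω → ℝ≥0) (p : SeminormFamily 𝕜 E A) : Type _ :=
  ↥(weightedSubmodule₀ ν p)

namespace CVZero

variable [T2Space Ω] (ν : J → Ω → ℝ≥0) (p : SeminormFamily 𝕜 E A)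

instance : AddCommGroup (CVZero ν p) := inferInstanceAs (AddCommGroup ↥(weightedSubmodule₀ ν p))

instance : Module 𝕜 (CVZero ν p) := inferInstanceAs (Module 𝕜 ↥(weightedSubmodule₀ ν p))

/-- The inclusion of `CV⁰₀(Ω, E)` into the continuous functions. -/
def toContinuousMap : CVZero ν p →ₗ[𝕜] C(Ω, E) := (weightedSubmodule₀ ν p).subtype

instance : CoeFun (CVZero ν p) (fun _ => Ω → E) := ⟨fun f => toContinuousMap ν p f⟩

theorem toContinuousMap_mem (f : CVZero ν p) : toContinuousMap ν p f ∈ weightedSubmodule₀ ν p :=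
  Subtype.property (p := (· ∈ weightedSubmodule₀ ν p)) f

/-- The seminorms `|f|_{j,α} = sup_Ω p_α(f) ν_j` of `CV⁰₀(Ω, E)`. -/
def seminorms : SeminormFamily 𝕜 (CVZero ν p) (J × A) := fun i =>
  Seminorm.of (fun f => (weightedSup (p i.2) (ν i.1) Set.univ f).toReal)
    (fun f g => by
      have hf := (toContinuousMap_mem ν p f).1 i.1 i.2
      have hg := (toContinuousMap_mem ν p g).1 i.1 i.2
      rw [← ENNReal.toReal_add hf.ne hg.ne, map_add]
      exact ENNReal.toReal_mono (ENNReal.add_ne_top.2 ⟨hf.ne, hg.ne⟩)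
        (weightedSup_add_le _ _ _ _ _))
    (fun c f => by
      rw [map_smul, ContinuousMap.coe_smul, weightedSup_smul, ENNReal.toReal_mul,
        ENNReal.toReal_ofReal (norm_nonneg c)])

instance : TopologicalSpace (CVZero ν p) := (seminorms ν p).moduleFilterBasis.topology

theorem withSeminorms : WithSeminorms (seminorms ν p) := ⟨rfl⟩

instance : IsTopologicalAddGroup (CVZero ν p) := (withSeminorms ν p).topologicalAddGroup

instance : ContinuousSMul 𝕜 (CVZero ν p) := (withSeminorms ν p).continuousSMul

end CVZero

end WeightedSpace

/-- The system of seminorms `{|·|}` of the scalar field. -/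
def scalarSeminorms (𝕜 : Type*) [RCLike 𝕜] : SeminormFamily 𝕜 𝕜 Unit := fun _ => normSeminorm 𝕜 𝕜

/-- `CV⁰₀(Ω) = CV⁰₀(Ω, 𝕜)`. -/
abbrev CVZeroScalar (𝕜 : Type*) {Ω J : Type*} [RCLike 𝕜] [TopologicalSpace Ω] [T2Space Ω]
    (ν : J → Ω → ℝ≥0) : Type _ :=
  CVZero ν (scalarSeminorms 𝕜)

/-! ### Dual spaces, `ε`-products, injective tensor products -/

section Tensor

variable (𝕜 : Type*) [RCLike 𝕜]

/-- `S` is absolutely convex. -/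
def IsAbsolutelyConvex {X : Type*} [AddCommGroup X] [Module 𝕜 X] (S : Set X) : Prop :=
  ∀ x ∈ S, ∀ y ∈ S, ∀ a b : 𝕜, ‖a‖ + ‖b‖ ≤ 1 → a • x + b • y ∈ S

/-- The absolutely convex compact subsets of `X`. -/
def absConvexCompacts (X : Type*) [AddCommGroup X] [Module 𝕜 X] [TopologicalSpace X] :
    Set (Set X) :=
  {K | IsAbsolutelyConvex 𝕜 K ∧ IsCompact K}

/-- `L_κ(X, Y)`: continuous linear maps with the topology of uniform convergence on the
absolutely convex compact subsets of `X`. -/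
abbrev KappaMaps (X Y : Type*) [AddCommGroup X] [Module 𝕜 X] [TopologicalSpace X]
    [AddCommGroup Y] [Module 𝕜 Y] [TopologicalSpace Y] : Type _ :=
  UniformConvergenceCLM (RingHom.id 𝕜) (E := X) Y (absConvexCompacts 𝕜 X)

/-- `F'_κ`. -/
abbrev KappaDual (F : Type*) [AddCommGroup F] [Module 𝕜 F] [TopologicalSpace F] : Type _ :=
  KappaMaps 𝕜 F 𝕜

/-- The equicontinuous subsets of `F'`. -/
def equicontinuousSets (F : Type*) [AddCommGroup F] [Module 𝕜 F] [TopologicalSpace F] :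
    Set (Set (KappaDual 𝕜 F)) :=
  {H | Equicontinuous fun (y : H) (f : F) => (y : KappaDual 𝕜 F) f}

/-- Schwartz' `ε`-product `F ε E = L_e(F'_κ, E)`. -/
abbrev EpsProduct (F E : Type*) [AddCommGroup F] [Module 𝕜 F] [TopologicalSpace F]
    [AddCommGroup E] [Module 𝕜 E] [TopologicalSpace E] : Type _ :=
  UniformConvergenceCLM (RingHom.id 𝕜) (E := KappaDual 𝕜 F) E (equicontinuousSets 𝕜 F)

variable {F E : Type*} [AddCommGroup F] [Module 𝕜 F] [TopologicalSpace F]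
  [ContinuousSMul 𝕜 F]

theorem exists_mem_absConvexCompacts (f : F) : ∃ K ∈ absConvexCompacts 𝕜 F, f ∈ K := by
  refine ⟨(fun a : 𝕜 => a • f) '' Metric.closedBall 0 1, ⟨?_, ?_⟩, 1, by simp, one_smul _ _⟩
  · rintro _ ⟨s, hs, rfl⟩ _ ⟨t, ht, rfl⟩ a b hab
    refine ⟨a * s + b * t, ?_, by simp only [add_smul, mul_smul]⟩
    rw [mem_closedBall_zero_iff] at hs ht ⊢
    calc ‖a * s + b * t‖ ≤ ‖a‖ * ‖s‖ + ‖b‖ * ‖t‖ := by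
          simpa only [norm_mul] using norm_add_le (a * s) (b * t)
      _ ≤ ‖a‖ * 1 + ‖b‖ * 1 := by gcongr
      _ ≤ 1 := by simpa using hab
  · exact (isCompact_closedBall (0 : 𝕜) 1).image (continuous_id.smul continuous_const)

theorem KappaDual.continuous_apply (f : F) : Continuous fun y : KappaDual 𝕜 F => y f := by
  have h : ⋃₀ absConvexCompacts 𝕜 F = Set.univ := by
    refine Set.eq_univ_of_forall fun g => ?_
    obtain ⟨K, hK, hg⟩ := exists_mem_absConvexCompacts 𝕜 g
    exact ⟨K, hK, hg⟩
  have := UniformConvergenceCLM.continuousEvalConst (RingHom.id 𝕜) 𝕜 (absConvexCompacts 𝕜 F) h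
  exact continuous_eval_const f

section

variable [AddCommGroup E] [Module 𝕜 E] [TopologicalSpace E] [IsTopologicalAddGroup E]
  [ContinuousSMul 𝕜 E]

/-- The element `y ↦ y(f) e` of `F ε E`. -/
def elementaryTensor (f : F) (e : E) : EpsProduct 𝕜 F E :=
  UniformConvergenceCLM.ofFun (RingHom.id 𝕜) E (equicontinuousSets 𝕜 F)
    { toFun := fun y => y f • e
      map_add' := fun y z => by
        rw [← add_smul]
        rfl
      map_smul' := fun c y => by
        rw [RingHom.id_apply, smul_smul]
        rfl
      cont := (KappaDual.continuous_apply 𝕜 f).smul continuous_const }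

/-- The map `Θ : F ⊗ E → F ε E`, `∑ fₙ ⊗ eₙ ↦ (y ↦ ∑ y(fₙ) eₙ)`. -/
def thetaMap : F ⊗[𝕜] E →ₗ[𝕜] EpsProduct 𝕜 F E :=
  TensorProduct.lift <| LinearMap.mk₂ 𝕜 (elementaryTensor 𝕜)
    (fun f g e => by
      ext y
      change y (f + g) • e = y f • e + y g • e
      rw [map_add, add_smul])
    (fun c f e => by
      ext y
      change y (c • f) • e = c • (y f • e)
      rw [map_smul, smul_eq_mul, mul_smul])
    (fun f d e => by
      ext y
      change y f • (d + e) = y f • d + y f • e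
      rw [smul_add])
    (fun c f e => by
      ext y
      change y f • (c • e) = c • (y f • e)
      rw [smul_comm])

end

/-- `F ⊗_ε E`: the algebraic tensor product, equipped below with the uniform structure (hence the
topology) induced by `Θ` from `F ε E`. -/
def InjTensor (𝕜 F E : Type*) [RCLike 𝕜] [AddCommGroup F] [Module 𝕜 F]
    [AddCommGroup E] [Module 𝕜 E] : Type _ :=
  F ⊗[𝕜] E

namespace InjTensor

instance [AddCommGroup E] [Module 𝕜 E] : AddCommGroup (InjTensor 𝕜 F E) :=
  inferInstanceAs (AddCommGroup (F ⊗[𝕜] E))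

instance [AddCommGroup E] [Module 𝕜 E] : Module 𝕜 (InjTensor 𝕜 F E) :=
  inferInstanceAs (Module 𝕜 (F ⊗[𝕜] E))

variable [AddCommGroup E] [Module 𝕜 E] [UniformSpace E] [IsUniformAddGroup E]
  [ContinuousSMul 𝕜 E]

/-- `Θ` as a map on `F ⊗_ε E`. -/
def theta : InjTensor 𝕜 F E →ₗ[𝕜] EpsProduct 𝕜 F E := thetaMap 𝕜 (F := F) (E := E)

instance : UniformSpace (InjTensor 𝕜 F E) :=
  UniformSpace.comap (theta 𝕜 (F := F) (E := E)) inferInstance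

instance : IsUniformAddGroup (InjTensor 𝕜 F E) :=
  IsUniformAddGroup.comap (theta 𝕜 (F := F) (E := E))

theorem isUniformInducing_theta : IsUniformInducing (theta 𝕜 (F := F) (E := E)) := ⟨rfl⟩

instance : UniformContinuousConstSMul 𝕜 (InjTensor 𝕜 F E) where
  uniformContinuous_const_smul c := by
    have : UniformContinuousConstSMul 𝕜 (EpsProduct 𝕜 F E) :=
      uniformContinuousConstSMul_of_continuousConstSMul 𝕜 _
    rw [(isUniformInducing_theta 𝕜 (F := F) (E := E)).uniformContinuous_iff]
    have h : theta 𝕜 (F := F) (E := E) ∘ (fun t => c • t) =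
        (fun u => c • u) ∘ theta 𝕜 (F := F) (E := E) :=
      funext fun t => map_smul _ c t
    rw [h]
    exact (uniformContinuous_const_smul c).comp
      (isUniformInducing_theta 𝕜 (F := F) (E := E)).uniformContinuous

end InjTensor

/-- `F ⊗̂_ε E`, the completion of the injective tensor product. -/
abbrev CompletedInjTensor (𝕜 F E : Type*) [RCLike 𝕜] [AddCommGroup F] [Module 𝕜 F]
    [TopologicalSpace F] [ContinuousSMul 𝕜 F] [AddCommGroup E] [Module 𝕜 E] [UniformSpace E]
    [IsUniformAddGroup E] [ContinuousSMul 𝕜 E] : Type _ :=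
  UniformSpace.Completion (InjTensor 𝕜 F E)

/-- Schwartz' approximation property: the identity of `X` is in the closure, in `L_κ(X)`, of the
set of continuous linear operators of finite rank. -/
def HasApproximationProperty (X : Type*) [AddCommGroup X] [Module 𝕜 X] [TopologicalSpace X]
    [IsTopologicalAddGroup X] : Prop :=
  UniformConvergenceCLM.ofFun (RingHom.id 𝕜) X (absConvexCompacts 𝕜 X)
      (ContinuousLinearMap.id 𝕜 X) ∈
    closure {T : KappaMaps 𝕜 X X |
      ∃ V : Submodule 𝕜 X, FiniteDimensional 𝕜 V ∧ ∀ x, T x ∈ V}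

end Tensor

/-! ### Point evaluations and the tensor products `C⁰_c(Ω) ⊗ E` -/

section Maps

variable {𝕜 Ω E J : Type*} [RCLike 𝕜] [TopologicalSpace Ω]

/-- The point evaluation `δ_x` as an element of `CV⁰₀(Ω)'`. -/
def evalDelta (𝕜 : Type*) [RCLike 𝕜] [T2Space Ω] {ν : J → Ω → ℝ≥0} (hν : IsWeightFamily ν)
    (x : Ω) : KappaDual 𝕜 (CVZeroScalar 𝕜 ν) :=
  UniformConvergenceCLM.ofFun (RingHom.id 𝕜) 𝕜 (absConvexCompacts 𝕜 (CVZeroScalar 𝕜 ν))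
    { toFun := fun f => f x
      map_add' := fun _ _ => rfl
      map_smul' := fun _ _ => rfl
      cont := by
        obtain ⟨j, hj⟩ := hν.pos x
        let L : CVZeroScalar 𝕜 ν →ₗ[𝕜] 𝕜 :=
          { toFun := fun f => f x, map_add' := fun _ _ => rfl, map_smul' := fun _ _ => rfl }
        change Continuous L
        refine (CVZero.withSeminorms ν (scalarSeminorms 𝕜)).continuous_normedSpace_rng
          𝕜 L ⟨{(j, ())}, (ν j x)⁻¹, ?_⟩
        intro f
        have hfin := (CVZero.toContinuousMap_mem ν (scalarSeminorms 𝕜) f).1 j ()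
        have h := ENNReal.toReal_mono hfin.ne (le_weightedSup (scalarSeminorms 𝕜 ()) (ν j)
          Set.univ f (Set.mem_univ x))
        rw [ENNReal.toReal_mul, ENNReal.toReal_ofReal (apply_nonneg _ _)] at h
        change ‖L f‖ * (ν j x : ℝ) ≤
          CVZero.seminorms ν (scalarSeminorms 𝕜) (j, ()) f at h
        rw [Finset.sup_singleton]
        change ‖L f‖ ≤ ((ν j x)⁻¹ : ℝ≥0) * CVZero.seminorms ν (scalarSeminorms 𝕜) (j, ()) f
        rw [NNReal.coe_inv, inv_mul_eq_div, le_div_iff₀ (by exact_mod_cast hj)]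
        exact h }

theorem evalDelta_apply [T2Space Ω] {ν : J → Ω → ℝ≥0} (hν : IsWeightFamily ν)
    (x : Ω) (f : CVZeroScalar 𝕜 ν) : evalDelta 𝕜 hν x f = f x := rfl

variable [AddCommGroup E] [Module 𝕜 E] [TopologicalSpace E] [IsTopologicalAddGroup E]
  [ContinuousSMul 𝕜 E]

/-- The linear map `C⁰_c(Ω) ⊗ E → C⁰(Ω, E)`, `∑ φₙ ⊗ eₙ ↦ (x ↦ ∑ φₙ(x) eₙ)`, by which
`C⁰_c(Ω) ⊗ E` is regarded as a space of `E`-valued functions. -/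
def tensorFun : C_c(Ω, 𝕜) ⊗[𝕜] E →ₗ[𝕜] C(Ω, E) :=
  TensorProduct.lift <| LinearMap.mk₂ 𝕜
    (fun φ e => ⟨fun x => φ x • e, (map_continuous φ).smul continuous_const⟩)
    (fun φ ψ e => by
      ext x
      exact add_smul (φ x) (ψ x) e)
    (fun c φ e => by
      ext x
      exact mul_smul c (φ x) e)
    (fun φ d e => by
      ext x
      exact smul_add (φ x) d e)
    (fun c φ e => by
      ext x
      exact smul_comm (φ x) c e)

theorem tensorFun_tmul_apply (φ : C_c(Ω, 𝕜)) (e : E) (x : Ω) :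
    tensorFun (φ ⊗ₜ[𝕜] e) x = φ x • e := by
  simp [tensorFun]

end Maps

end

open Filter Topology Set

/-! Everything rests on one construction. Given a compact `L`, take finitely many compactly
supported `φᵢ ≥ 0` with sum `≤ 1`, equal to `1` on `L`, each supported near a point `xᵢ`, and
replace `f` by `∑ φᵢ f(xᵢ)`. The error at `x` is `(1 - ∑ φᵢ(x)) f(x) + ∑ φᵢ(x) (f(x) - f(xᵢ))`: the
first term vanishes on `L` and is small off `L` if `f` is, and the second is controlled by the
oscillation of `f`. The choice works at once for a whole set of functions that is equicontinuous and
uniformly small at infinity (`exists_partition_approx`).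

For a single function this gives (a) and (b). Compact subsets of `F = CV⁰₀(Ω)` have the two uniform
properties, so the finite rank operators `f ↦ ∑ f(xᵢ) φᵢ` approximate the identity in `L_κ(F)`
(`id_mem_closure_pointOperators`); this is (d).

For (c), let `S(u)(x) = u(δ_x)`. The transpose identity `e(u(y)) = y(e ∘ S(u))` is clear when `y` is
a combination of point evaluations, and `y ∘ T` is one for each such operator `T`; letting `T → id`
gives it for all `y`. With Hahn-Banach it shows that `S` is a topological embedding. For
surjectivity, `y` is first applied to tensors, and the resulting map is extended by density from `F
⊗ E` to `CV⁰₀(Ω, E)`, using that `E` is complete. At a fixed `g`, the extension is continuous in `y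
∈ F'_κ` because the functions `e ∘ g` with `|e| ≤ p_α` lie in one absolutely convex compact set
(`isCompact_dominatedSet`). Finally `CV⁰₀(Ω, E)` is complete, hence so is `F ε E`, and `Θ` has dense
range; so `F ε E` is the completion of `F ⊗_ε E`. -/

/-! ### Approximation by partitions of unity -/

theorem exists_finset_partition_of_isCompact {Ω : Type*} [TopologicalSpace Ω] [T2Space Ω]
    [LocallyCompactSpace Ω] {L V : Set Ω} (hL : IsCompact L) (hV : IsOpen V) (hLV : L ⊆ V)
    {N : Ω → Set Ω} (hN : ∀ x, N x ∈ 𝓝 x) :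
    ∃ (s : Finset Ω) (φ : s → C(Ω, ℝ)), (∀ i x, 0 ≤ φ i x) ∧ (∀ i, HasCompactSupport (φ i)) ∧
      (∀ i, tsupport (φ i) ⊆ V ∩ N i) ∧ (∀ x, ∑ i, φ i x ≤ 1) ∧ ∀ x ∈ L, ∑ i, φ i x = 1 := by
  obtain ⟨s, -, hs⟩ := hL.elim_nhds_subcover (fun x => interior (N x))
    fun x _ => interior_mem_nhds.2 (hN x)
  obtain ⟨φ, hφ, hc⟩ := PartitionOfUnity.exists_isSubordinate_of_locallyFinite_t2space hL
    (fun i : s => V ∩ interior (N i)) (fun i => hV.inter isOpen_interior)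
    (locallyFinite_of_finite _) fun x hx => by
      obtain ⟨i, hi, hxi⟩ := mem_iUnion₂.1 (hs hx)
      exact mem_iUnion.2 ⟨⟨i, hi⟩, hLV hx, hxi⟩
  refine ⟨s, fun i => φ i, φ.nonneg, hc,
    fun i => (hφ i).trans (inter_subset_inter_right _ interior_subset), fun x => ?_, fun x hx => ?_⟩
  · rw [← finsum_eq_sum_of_fintype]
    exact φ.sum_le_one x
  · rw [← finsum_eq_sum_of_fintype]
    exact φ.sum_eq_one hx

/-- Split `v = (1 - ∑ cᵢ) v + ∑ cᵢ v`. Closeness of `w i` to `v` is required only where `c i ≠ 0`,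
since `f(xᵢ)` is near `f(x)` only for `x` in the support of `φᵢ`. -/
theorem Seminorm.sub_sum_smul_le {𝕜 E ι : Type*} [RCLike 𝕜] [AddCommGroup E] [Module 𝕜 E]
    [Fintype ι] (q : Seminorm 𝕜 E) {c : ι → ℝ} (hc : ∀ i, 0 ≤ c i) (hc1 : ∑ i, c i ≤ 1)
    (v : E) {w : ι → E} {δ : ℝ} (h : ∀ i, c i ≠ 0 → q (v - w i) ≤ δ) :
    q (v - ∑ i, (c i : 𝕜) • w i) ≤ (1 - ∑ i, c i) * q v + (∑ i, c i) * δ := by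
  have hv : v - ∑ i, (c i : 𝕜) • w i =
      ((1 - ∑ i, c i : ℝ) : 𝕜) • v + ∑ i, (c i : 𝕜) • (v - w i) := by
    simp only [smul_sub, Finset.sum_sub_distrib, ← Finset.sum_smul]
    push_cast
    rw [sub_smul, one_smul]
    abel
  rw [hv]
  refine (map_add_le_add q _ _).trans (add_le_add ?_ ?_)
  · rw [map_smul_eq_mul, RCLike.norm_ofReal, abs_of_nonneg (sub_nonneg.2 hc1)]
  · rw [Finset.sum_mul]
    refine (Finset.le_sum_of_subadditive q (map_zero q).le (map_add_le_add q) _ _).trans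
      (Finset.sum_le_sum fun i _ => ?_)
    rw [map_smul_eq_mul, RCLike.norm_ofReal, abs_of_nonneg (hc i)]
    by_cases hi : c i = 0
    · simp [hi]
    · exact mul_le_mul_of_nonneg_left (h i hi) (hc i)

/-- Simultaneous approximation of a family of functions by sums `∑ φᵢ f(xᵢ)`, with respect to
finitely many weighted seminorms. -/
theorem exists_partition_approx {𝕜 Ω E κ : Type*} [RCLike 𝕜] [TopologicalSpace Ω] [T2Space Ω]
    [LocallyCompactSpace Ω] [AddCommGroup E] [Module 𝕜 E] (I : Finset κ) (q : κ → Seminorm 𝕜 E)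
    (w : κ → Ω → ℝ≥0) (hw : ∀ K : Set Ω, IsCompact K → ∀ k, ∃ C : ℝ≥0, ∀ x ∈ K, w k x ≤ C)
    {B : Set (Ω → E)}
    (hB : ∀ k ∈ I, ∀ x₀, ∀ δ : ℝ, 0 < δ → ∀ᶠ x in 𝓝 x₀, ∀ f ∈ B, q k (f x - f x₀) ≤ δ)
    {L V : Set Ω} (hL : IsCompact L) (hV : IsOpen V) (hLV : L ⊆ V) {ε : ℝ} (hε : 0 < ε)
    (hBL : ∀ k ∈ I, ∀ f ∈ B, ∀ x ∉ L, q k (f x) * w k x ≤ ε) :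
    ∃ (s : Finset Ω) (φ : s → C_c(Ω, 𝕜)), (∀ i, tsupport (φ i) ⊆ V) ∧
      ∀ k ∈ I, ∀ f ∈ B, ∀ x, q k (f x - ∑ i, φ i x • f i) * w k x ≤ 2 * ε := by
  -- The supports are kept inside one compact `K ⊆ V`, where the weights are bounded.
  obtain ⟨K, hK, hLK, hKV⟩ := exists_compact_between hL hV hLV
  choose C hC using hw K hK
  -- This exceeds every `C k` with `k ∈ I` and is nonzero, so the oscillation bound `ε / (1 + ∑ C
  -- k)` times any of these weights is at most `ε` on `K`.
  have hM : 0 < 1 + ∑ k ∈ I, (C k : ℝ) := by positivity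
  obtain ⟨s, φ, h0, hc, hsub, h1, hL1⟩ := exists_finset_partition_of_isCompact hL isOpen_interior
    hLK (N := fun x₀ => {x | ∀ k ∈ I, ∀ f ∈ B, q k (f x - f x₀) ≤ ε / (1 + ∑ k ∈ I, (C k : ℝ))})
    fun x₀ => (I.eventually_all).2 fun k hk => hB k hk x₀ _ (by positivity)
  refine ⟨s, fun i => ⟨⟨fun x => (φ i x : 𝕜), by fun_prop⟩,
    (hc i).comp_left (g := ((↑) : ℝ → 𝕜)) RCLike.ofReal_zero⟩, fun i => ?_, fun k hk f hf x => ?_⟩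
  · refine (closure_mono fun x hx => ?_).trans
      (((hsub i).trans inter_subset_left).trans (interior_subset.trans hKV))
    rw [Function.mem_support] at hx ⊢
    contrapose! hx
    change ((φ i x : ℝ) : 𝕜) = 0
    rw [hx, RCLike.ofReal_zero]
  · have key := (q k).sub_sum_smul_le (fun i => h0 i x) (h1 x) (f x) (w := fun i : s => f i)
      (δ := ε / (1 + ∑ k ∈ I, (C k : ℝ)))
      fun i hi => (hsub i (subset_closure (Function.mem_support.2 hi))).2 k hk f hf
    refine (mul_le_mul_of_nonneg_right key (w k x).2).trans ?_
    rw [add_mul, two_mul]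
    have hs0 : 0 ≤ ∑ i, φ i x := Finset.sum_nonneg fun i _ => h0 i x
    -- The first term is zero on `L` and at most `ε` off `L`; the second is at most `ε` on `K` and
    -- zero off `K`.
    refine add_le_add ?_ ?_
    · by_cases hx : x ∈ L
      · rw [hL1 x hx, sub_self, zero_mul, zero_mul]
        exact hε.le
      · rw [mul_assoc]
        have hnn : 0 ≤ q k (f x) * w k x := mul_nonneg (apply_nonneg _ _) (w k x).2
        exact (mul_le_of_le_one_left hnn (by linarith)).trans (hBL k hk f hf x hx)
    · by_cases hx : x ∈ K
      · rw [mul_assoc]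
        refine (mul_le_of_le_one_left (mul_nonneg (by positivity) (w k x).2) (h1 x)).trans ?_
        rw [div_mul_eq_mul_div, div_le_iff₀ hM]
        gcongr
        calc (w k x : ℝ) ≤ C k := hC k x hx
          _ ≤ ∑ k ∈ I, (C k : ℝ) := Finset.single_le_sum (f := fun k => (C k : ℝ))
              (fun k _ => (C k).2) hk
          _ ≤ _ := by linarith
      · have h : ∑ i, φ i x = 0 := Finset.sum_eq_zero fun i _ => by
          by_contra hi
          exact hx (interior_subset (hsub i (subset_closure (Function.mem_support.2 hi))).1)
        rw [h, zero_mul, zero_mul]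
        exact hε.le

/-! ### Weighted seminorms in real terms; compact sets in the weighted space -/

theorem weightedSup_le_ofReal_iff {𝕜 Ω E : Type*} [RCLike 𝕜] [AddCommGroup E] [Module 𝕜 E]
    (q : Seminorm 𝕜 E) (w : Ω → ℝ≥0) (S : Set Ω) (f : Ω → E) {C : ℝ} (hC : 0 ≤ C) :
    weightedSup q w S f ≤ ENNReal.ofReal C ↔ ∀ x ∈ S, q (f x) * w x ≤ C := by
  rw [weightedSup_le_iff]
  refine forall₂_congr fun x _ => ?_
  rw [← ENNReal.ofReal_coe_nnreal, ← ENNReal.ofReal_mul (apply_nonneg q _),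
    ENNReal.ofReal_le_ofReal_iff hC]

section API

variable {𝕜 Ω E J A : Type*} [RCLike 𝕜] [TopologicalSpace Ω] [T2Space Ω]
  [AddCommGroup E] [Module 𝕜 E] [TopologicalSpace E] [IsTopologicalAddGroup E]
  [ContinuousSMul 𝕜 E] {ν : J → Ω → ℝ≥0} {p : SeminormFamily 𝕜 E A}

theorem mem_weightedSubmodule₀_iff {f : C(Ω, E)} :
    f ∈ weightedSubmodule₀ ν p ↔ ∀ j α, (∃ M : ℝ, ∀ x, p α (f x) * ν j x ≤ M) ∧
      ∀ ε : ℝ, 0 < ε → ∃ K : Set Ω, IsCompact K ∧ ∀ x ∉ K, p α (f x) * ν j x ≤ ε := by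
  constructor
  · intro hf j α
    refine ⟨⟨(weightedSup (p α) (ν j) univ f).toReal, fun x => ?_⟩, fun ε hε => ?_⟩
    · refine (weightedSup_le_ofReal_iff (p α) (ν j) univ f ENNReal.toReal_nonneg).1 ?_ x (mem_univ x)
      rw [ENNReal.ofReal_toReal (hf.1 j α).ne]
    · obtain ⟨K, hK, h⟩ := hf.2 j α (ENNReal.ofReal ε) (ENNReal.ofReal_pos.2 hε)
      exact ⟨K, hK, (weightedSup_le_ofReal_iff (p α) (ν j) Kᶜ f hε.le).1 h.le⟩
  · intro h
    refine ⟨fun j α => ?_, fun j α ε hε => ?_⟩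
    · obtain ⟨M, hM⟩ := (h j α).1
      exact ((weightedSup_le_ofReal_iff (p α) (ν j) univ f (le_max_right M 0)).2
        fun x _ => (hM x).trans (le_max_left _ _)).trans_lt ENNReal.ofReal_lt_top
    -- The required bound is strict and `ε` may be `∞`; a real `r` strictly between `0` and `ε`
    -- handles both.
    · obtain ⟨r, hr0, hr⟩ := ENNReal.lt_iff_exists_real_btwn.1 hε
      rw [ENNReal.ofReal_pos] at hr
      obtain ⟨K, hK, hfK⟩ := (h j α).2 r hr.1
      exact ⟨K, hK, ((weightedSup_le_ofReal_iff (p α) (ν j) Kᶜ f hr0).2 hfK).trans_lt hr.2⟩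

/-- A continuous function with compact support lies in `CV⁰₀(Ω, E)` if the weights are locally
bounded. -/
theorem mem_weightedSubmodule₀_of_hasCompactSupport (hp : ∀ α, Continuous (p α))
    (hbdd : IsLocallyBoundedFamily ν) {f : C(Ω, E)} (hf : HasCompactSupport f) :
    f ∈ weightedSubmodule₀ ν p := by
  refine mem_weightedSubmodule₀_iff.2 fun j α => ?_
  have h0 : ∀ x ∉ tsupport f, p α (f x) * ν j x = 0 := fun x hx => by
    rw [image_eq_zero_of_notMem_tsupport hx, map_zero, zero_mul]
  refine ⟨?_, fun ε hε => ⟨tsupport f, hf, fun x hx => (h0 x hx).trans_le hε.le⟩⟩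
  obtain ⟨C, hC⟩ := hbdd _ hf j
  obtain ⟨D, hD⟩ := hf.isCompact.bddAbove_image ((hp α).comp f.continuous).continuousOn
  -- If the support is empty, the bound `D` may be negative.
  refine ⟨max D 0 * C, fun x => ?_⟩
  by_cases hx : x ∈ tsupport f
  · exact mul_le_mul ((hD (mem_image_of_mem _ hx)).trans (le_max_left _ _)) (hC x hx) (ν j x).2
      (le_max_right _ _)
  · rw [h0 x hx]
    positivity

namespace CVZero

@[ext]
theorem ext {f g : CVZero ν p} (h : ∀ x, f x = g x) : f = g :=
  Subtype.ext (ContinuousMap.ext h)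

/-- An element of `CV⁰₀(Ω, E)` from a continuous function. -/
def mk (f : C(Ω, E)) (hf : f ∈ weightedSubmodule₀ ν p) : CVZero ν p := ⟨f, hf⟩

theorem add_apply (f g : CVZero ν p) (x : Ω) : (f + g) x = f x + g x := rfl

theorem sub_apply (f g : CVZero ν p) (x : Ω) : (f - g) x = f x - g x := rfl

theorem smul_apply (c : 𝕜) (f : CVZero ν p) (x : Ω) : (c • f) x = c • f x := rfl

theorem sum_apply {ι : Type*} (s : Finset ι) (f : ι → CVZero ν p) (x : Ω) :
    (∑ i ∈ s, f i) x = ∑ i ∈ s, f i x := by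
  simp only [map_sum, ContinuousMap.coe_sum, Finset.sum_apply]

theorem apply_mul_le_seminorms (f : CVZero ν p) (j : J) (α : A) (x : Ω) :
    p α (f x) * ν j x ≤ seminorms ν p (j, α) f := by
  refine (weightedSup_le_ofReal_iff (p α) (ν j) univ f ENNReal.toReal_nonneg).1 ?_ x (mem_univ x)
  exact (ENNReal.ofReal_toReal ((toContinuousMap_mem ν p f).1 j α).ne).ge

theorem seminorms_le_iff {f : CVZero ν p} {j : J} {α : A} {M : ℝ} (hM : 0 ≤ M) :
    seminorms ν p (j, α) f ≤ M ↔ ∀ x, p α (f x) * ν j x ≤ M := by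
  refine ⟨fun h x => (apply_mul_le_seminorms f j α x).trans h, fun h => ?_⟩
  exact ENNReal.toReal_le_of_le_ofReal hM
    ((weightedSup_le_ofReal_iff (p α) (ν j) univ f hM).2 fun x _ => h x)

theorem exists_isCompact_apply_mul_le (f : CVZero ν p) (j : J) (α : A) {ε : ℝ} (hε : 0 < ε) :
    ∃ K : Set Ω, IsCompact K ∧ ∀ x ∉ K, p α (f x) * ν j x ≤ ε :=
  (mem_weightedSubmodule₀_iff.1 (toContinuousMap_mem ν p f) j α).2 ε hε

/-- A compact subset of `CV⁰₀(Ω, E)` vanishes at infinity uniformly. -/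
theorem exists_isCompact_forall_apply_mul_le {B : Set (CVZero ν p)} (hB : IsCompact B) (j : J)
    (α : A) {ε : ℝ} (hε : 0 < ε) :
    ∃ K : Set Ω, IsCompact K ∧ ∀ f ∈ B, ∀ x ∉ K, p α (f x) * ν j x ≤ ε := by
  -- A finite `ε / 2`-net of `B`: the union of the compact sets belonging to its members serves all
  -- of `B`.
  obtain ⟨t, -, ht⟩ := hB.elim_nhds_subcover (fun f => {g | seminorms ν p (j, α) (g - f) < ε / 2})
    fun f _ => by
      have hc : Continuous fun g => seminorms ν p (j, α) (g - f) :=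
        ((withSeminorms ν p).continuous_seminorm (j, α)).comp (continuous_id.sub continuous_const)
      refine hc.continuousAt.eventually_lt continuousAt_const ?_
      simpa using hε
  choose K hK hfK using fun f : CVZero ν p => exists_isCompact_apply_mul_le f j α (half_pos hε)
  refine ⟨⋃ f ∈ t, K f, t.isCompact_biUnion fun f _ => hK f, fun g hg x hx => ?_⟩
  obtain ⟨f, hf, hgf⟩ := mem_iUnion₂.1 (ht hg)
  have hxf : x ∉ K f := fun h => hx (mem_iUnion₂.2 ⟨f, hf, h⟩)
  have h1 := (apply_mul_le_seminorms (g - f) j α x).trans (le_of_lt hgf)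
  have h2 := hfK f x hxf
  have h3 : p α (g x) ≤ p α ((g - f) x) + p α (f x) := by
    simpa [sub_apply] using map_add_le_add (p α) (g x - f x) (f x)
  calc p α (g x) * ν j x ≤ (p α ((g - f) x) + p α (f x)) * ν j x := by gcongr
    _ ≤ ε := by linarith

theorem continuous_linearMap_of_le {X : Type*} [AddCommGroup X] [Module 𝕜 X] [TopologicalSpace X]
    {q : SeminormFamily 𝕜 X A} (hq : WithSeminorms q) (T : CVZero ν p →ₗ[𝕜] X)
    (h : ∀ α, ∃ (i : J × A) (C : ℝ≥0), ∀ f, q α (T f) ≤ C * seminorms ν p i f) : Continuous T :=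
  (withSeminorms ν p).continuous_of_isBounded hq T fun α => by
    obtain ⟨i, C, hC⟩ := h α
    exact ⟨{i}, C, fun f => by
      rw [Finset.sup_singleton]
      exact hC f⟩

end CVZero

end API

theorem withSeminorms_scalarSeminorms (𝕜 : Type*) [RCLike 𝕜] :
    WithSeminorms (scalarSeminorms 𝕜) := by
  rw [SeminormFamily.withSeminorms_iff_nhds_eq_iInf]
  exact comap_norm_nhds_zero.symm.trans (iInf_const (ι := Unit)).symm

namespace CVZero

section

variable {𝕜 Ω E J A : Type*} [RCLike 𝕜] [TopologicalSpace Ω] [T2Space Ω]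
  [AddCommGroup E] [Module 𝕜 E] {ν : J → Ω → ℝ≥0} {p : SeminormFamily 𝕜 E A}

section

variable [TopologicalSpace E] [IsTopologicalAddGroup E] [ContinuousSMul 𝕜 E]

theorem continuous_eval (hp : WithSeminorms p) (hν : IsWeightFamily ν) (x : Ω) :
    Continuous fun f : CVZero ν p => f x := by
  obtain ⟨j, hj⟩ := hν.pos x
  refine continuous_linearMap_of_le hp
    ({ toFun := fun f => f x, map_add' := fun _ _ => rfl, map_smul' := fun _ _ => rfl } :
      CVZero ν p →ₗ[𝕜] E) fun α => ⟨(j, α), (ν j x)⁻¹, fun f => ?_⟩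
  rw [NNReal.coe_inv, inv_mul_eq_div, le_div_iff₀ (by exact_mod_cast hj)]
  exact apply_mul_le_seminorms f j α x

theorem comp_mem (e : E →L[𝕜] 𝕜) (α : A) (he : ∀ v, ‖e v‖ ≤ p α v) (f : CVZero ν p) :
    (⟨fun x => e (f x), e.continuous.comp (toContinuousMap ν p f).continuous⟩ : C(Ω, 𝕜)) ∈
      weightedSubmodule₀ ν (scalarSeminorms 𝕜) := by
  refine mem_weightedSubmodule₀_iff.2 fun j _ => ?_
  have h : ∀ x, ‖e (f x)‖ * ν j x ≤ p α (f x) * ν j x := fun x => by gcongr; exact he _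
  refine ⟨⟨seminorms ν p (j, α) f, fun x => (h x).trans (apply_mul_le_seminorms f j α x)⟩,
    fun ε hε => ?_⟩
  obtain ⟨K, hK, hfK⟩ := exists_isCompact_apply_mul_le f j α hε
  exact ⟨K, hK, fun x hx => (h x).trans (hfK x hx)⟩

/-- The map `f ↦ e ∘ f` from `CV⁰₀(Ω, E)` to `CV⁰₀(Ω)`. -/
def compScalar (e : E →L[𝕜] 𝕜) (α : A) (he : ∀ v, ‖e v‖ ≤ p α v) :
    CVZero ν p →ₗ[𝕜] CVZeroScalar 𝕜 ν where
  toFun f := mk _ (comp_mem e α he f)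
  map_add' f g := by
    ext x
    exact map_add e (f x) (g x)
  map_smul' c f := by
    ext x
    exact map_smul e c (f x)

theorem compScalar_apply (e : E →L[𝕜] 𝕜) (α : A) (he : ∀ v, ‖e v‖ ≤ p α v) (f : CVZero ν p)
    (x : Ω) : compScalar e α he f x = e (f x) := rfl

theorem seminorms_compScalar_le (e : E →L[𝕜] 𝕜) (α : A) (he : ∀ v, ‖e v‖ ≤ p α v)
    (f : CVZero ν p) (j : J) :
    seminorms ν (scalarSeminorms 𝕜) (j, ()) (compScalar e α he f) ≤ seminorms ν p (j, α) f := by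
  refine (seminorms_le_iff (apply_nonneg _ _)).2 fun x =>
    le_trans ?_ (apply_mul_le_seminorms f j α x)
  exact mul_le_mul_of_nonneg_right (he _) (ν j x).2

theorem continuous_compScalar (e : E →L[𝕜] 𝕜) (α : A) (he : ∀ v, ‖e v‖ ≤ p α v) :
    Continuous (compScalar (ν := ν) e α he) := by
  refine (withSeminorms ν p).continuous_of_isBounded (withSeminorms ν (scalarSeminorms 𝕜)) _
    fun i => ⟨{(i.1, α)}, 1, fun f => ?_⟩
  simpa using seminorms_compScalar_le e α he f i.1

end

section

variable [UniformSpace E] [IsUniformAddGroup E] [ContinuousSMul 𝕜 E]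

/-- The weighted topology is finer than the compact-open one: if `ν j ≥ c > 0` on `K`, then
`|f|_{j,α} < r c` forces `p_α(f) < r` on `K`. -/
theorem continuous_toContinuousMap (hp : WithSeminorms p) (haway : IsLocallyBoundedAwayFromZero ν) :
    Continuous (toContinuousMap ν p) := by
  refine continuous_of_continuousAt_zero (toContinuousMap ν p) ?_
  rw [ContinuousAt, map_zero, ContinuousMap.tendsto_iff_forall_isCompact_tendstoUniformlyOn]
  intro K hK V hV
  rw [uniformity_eq_comap_nhds_zero, mem_comap] at hV
  obtain ⟨U, hU, hUV⟩ := hV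
  obtain ⟨s, r, hr, hs⟩ := (hp.mem_nhds_iff 0 U).1 hU
  obtain ⟨j, c, hc, hj⟩ := haway K hK
  have h : ∀ᶠ f in 𝓝 (0 : CVZero ν p), ∀ α ∈ s, seminorms ν p (j, α) f < r * c :=
    s.eventually_all.2 fun α _ => by
      refine ((withSeminorms ν p).continuous_seminorm (j, α)).continuousAt.eventually_lt
        continuousAt_const ?_
      rw [map_zero]
      positivity
  filter_upwards [h] with f hf x hx
  refine hUV (hs ?_)
  rw [Seminorm.mem_ball, sub_zero]
  refine Seminorm.finset_sup_apply_lt hr fun α hα => ?_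
  have hc' : (0 : ℝ) < c := by exact_mod_cast hc
  refine lt_of_mul_lt_mul_right ?_ hc'.le
  calc p α (f x - 0) * c ≤ p α (f x) * ν j x := by
        rw [sub_zero]
        gcongr
        exact hj x hx
    _ < r * c := (apply_mul_le_seminorms f j α x).trans_lt (hf α hα)

/-- A compact subset of `CV⁰₀(Ω, E)` is equicontinuous. -/
theorem eventually_forall_mem_of_isCompact [LocallyCompactSpace Ω] (hp : WithSeminorms p)
    (haway : IsLocallyBoundedAwayFromZero ν) {B : Set (CVZero ν p)} (hB : IsCompact B) (α : A)
    (x₀ : Ω) {δ : ℝ} (hδ : 0 < δ) :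
    ∀ᶠ x in 𝓝 x₀, ∀ f ∈ B, p α (f x - f x₀) ≤ δ := by
  have hT := continuous_toContinuousMap hp haway
  -- By compactness of `B` it is enough to argue near each `(x₀, f)`, where evaluation is jointly
  -- continuous because `Ω` is locally compact.
  refine hB.eventually_forall_of_forall_eventually fun f _ => ?_
  have hc : Continuous fun z : Ω × CVZero ν p =>
      p α (toContinuousMap ν p z.2 z.1 - toContinuousMap ν p z.2 x₀) :=
    (hp.continuous_seminorm α).comp (by fun_prop)
  refine (hc.continuousAt.eventually_lt continuousAt_const ?_).mono fun z hz => hz.le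
  simpa using hδ

end

end

end CVZero

/-! ### Density of `C⁰_c(Ω) ⊗ E`: statements (a) and (b) -/

section Density

variable {𝕜 Ω E J A : Type*} [RCLike 𝕜] [TopologicalSpace Ω]
  [AddCommGroup E] [Module 𝕜 E] [TopologicalSpace E] [IsTopologicalAddGroup E]
  [ContinuousSMul 𝕜 E] {ν : J → Ω → ℝ≥0} {p : SeminormFamily 𝕜 E A}

theorem tensorFun_sum_tmul_apply {ι : Type*} [Fintype ι] (φ : ι → C_c(Ω, 𝕜)) (v : ι → E) (x : Ω) :
    tensorFun (∑ i, φ i ⊗ₜ[𝕜] v i) x = ∑ i, φ i x • v i := by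
  simp only [map_sum, ContinuousMap.coe_sum, Finset.sum_apply, tensorFun_tmul_apply]

theorem hasCompactSupport_tensorFun (t : C_c(Ω, 𝕜) ⊗[𝕜] E) : HasCompactSupport (tensorFun t) := by
  induction t with
  | zero =>
    rw [map_zero]
    exact HasCompactSupport.zero
  | tmul φ e =>
    have h : ⇑(tensorFun (φ ⊗ₜ[𝕜] e)) = fun x => φ x • e := funext (tensorFun_tmul_apply φ e)
    rw [h]
    exact φ.hasCompactSupport.smul_right
  | add s t hs ht =>
    rw [map_add]
    exact hs.add ht

variable [T2Space Ω]

theorem tensorFun_mem_weightedSubmodule₀ (hp : WithSeminorms p) (hbdd : IsLocallyBoundedFamily ν)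
    (t : C_c(Ω, 𝕜) ⊗[𝕜] E) : tensorFun t ∈ weightedSubmodule₀ ν p :=
  mem_weightedSubmodule₀_of_hasCompactSupport hp.continuous_seminorm hbdd
    (hasCompactSupport_tensorFun t)

variable [LocallyCompactSpace Ω]

/-- The case of a single function, common to (a) and (b): `V = Ω` for density, `L = supp f` for the
approximation with supports. -/
theorem exists_tensorFun_approx (hp : WithSeminorms p) (hbdd : IsLocallyBoundedFamily ν)
    (I : Finset (J × A)) (f : C(Ω, E)) {L V : Set Ω} (hL : IsCompact L) (hV : IsOpen V)
    (hLV : L ⊆ V) {ε : ℝ} (hε : 0 < ε) (hf : ∀ i ∈ I, ∀ x ∉ L, p i.2 (f x) * ν i.1 x ≤ ε) :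
    ∃ t : C_c(Ω, 𝕜) ⊗[𝕜] E, tsupport (tensorFun t) ⊆ V ∧
      ∀ i ∈ I, ∀ x, p i.2 (f x - tensorFun t x) * ν i.1 x ≤ 2 * ε := by
  obtain ⟨s, φ, hφ, h⟩ := exists_partition_approx (𝕜 := 𝕜) I (fun i => p i.2) (fun i => ν i.1)
    (fun K hK i => hbdd K hK i.1) (B := {⇑f}) (fun i _ x₀ δ hδ => by
      have hc : Continuous fun x => p i.2 (f x - f x₀) :=
        (hp.continuous_seminorm i.2).comp (f.continuous.sub continuous_const)
      have := hc.continuousAt (x := x₀) |>.eventually_lt continuousAt_const (by simpa using hδ)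
      exact this.mono fun x hx g hg => by rw [hg]; exact hx.le) hL hV hLV hε
    (fun i hi g hg => by rw [hg]; exact hf i hi)
  refine ⟨∑ i, φ i ⊗ₜ f i, ?_, fun i hi x => ?_⟩
  · have hsub : tsupport (tensorFun (∑ i, φ i ⊗ₜ[𝕜] f i)) ⊆ ⋃ i, tsupport (φ i) := by
      refine closure_minimal (fun x hx => ?_)
        (isClosed_iUnion_of_finite fun i => isClosed_tsupport _)
      rw [Function.mem_support, tensorFun_sum_tmul_apply] at hx
      obtain ⟨i, -, hi⟩ := Finset.exists_ne_zero_of_sum_ne_zero hx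
      exact mem_iUnion.2 ⟨i, subset_closure (left_ne_zero_of_smul hi)⟩
    exact hsub.trans (iUnion_subset hφ)
  · rw [tensorFun_sum_tmul_apply]
    exact h i hi f rfl x

theorem exists_tensorFun_tsupport_subset (hp : WithSeminorms p) (hbdd : IsLocallyBoundedFamily ν)
    (f : C(Ω, E)) (hf : HasCompactSupport f) (V : Set Ω) (hV : IsOpen V) (hfV : tsupport f ⊆ V)
    (ε : ℝ) (hε : 0 < ε) (j : J) (α : A) :
    ∃ g : C_c(Ω, 𝕜) ⊗[𝕜] E, tsupport (tensorFun g) ⊆ V ∧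
      weightedSup (p α) (ν j) univ (f - tensorFun g) ≤ ENNReal.ofReal ε := by
  obtain ⟨t, ht, h⟩ := exists_tensorFun_approx hp hbdd {(j, α)} f hf hV hfV (half_pos hε)
    fun i _ x hx => by
      rw [image_eq_zero_of_notMem_tsupport hx, map_zero, zero_mul]
      exact (half_pos hε).le
  refine ⟨t, ht, (weightedSup_le_ofReal_iff _ _ _ _ hε.le).2 fun x _ => ?_⟩
  simpa [mul_div_cancel₀] using h (j, α) (Finset.mem_singleton_self _) x

theorem dense_tensorFun (hp : WithSeminorms p) (hbdd : IsLocallyBoundedFamily ν) :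
    Dense {f : CVZero ν p | ∃ t : C_c(Ω, 𝕜) ⊗[𝕜] E,
      CVZero.toContinuousMap ν p f = tensorFun t} := by
  intro f
  refine mem_closure_iff_nhds.2 fun U hU => ?_
  obtain ⟨I, r, hr, hI⟩ := ((CVZero.withSeminorms ν p).mem_nhds_iff f U).1 hU
  choose K hK hfK using fun i : J × A =>
    CVZero.exists_isCompact_apply_mul_le f i.1 i.2 (ε := r / 4) (by positivity)
  obtain ⟨t, -, h⟩ := exists_tensorFun_approx hp hbdd I (CVZero.toContinuousMap ν p f)
    (L := ⋃ i ∈ I, K i) (I.isCompact_biUnion fun i _ => hK i) isOpen_univ (subset_univ _)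
    (ε := r / 4) (by positivity)
    fun i hi x hx => hfK i x fun hxi => hx (mem_iUnion₂.2 ⟨i, hi, hxi⟩)
  refine ⟨CVZero.mk _ (tensorFun_mem_weightedSubmodule₀ hp hbdd t), hI ?_, t, rfl⟩
  rw [Seminorm.mem_ball]
  refine Seminorm.finset_sup_apply_lt hr fun i hi => ?_
  rw [map_sub_rev]
  refine lt_of_le_of_lt ((CVZero.seminorms_le_iff (M := 2 * (r / 4)) (by positivity)).2
    fun x => h i hi x) (by linarith)

end Density

/-! ### Norming functionals, `L_κ` and the `ε`-product -/

section General

variable {𝕜 : Type*} [RCLike 𝕜]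

/-- Scale `x` by `a⁻¹` for an arbitrary `a > r⁻¹ q₁(x)`; such an `a` is positive even when `q₁(x) =
0`. -/
theorem Seminorm.le_mul_of_forall_lt {X : Type*} [AddCommGroup X] [Module 𝕜 X]
    {q₁ q₂ : Seminorm 𝕜 X} {r : ℝ} (hr : 0 < r) (h : ∀ x, q₁ x < r → q₂ x ≤ 1) (x : X) :
    q₂ x ≤ r⁻¹ * q₁ x := by
  refine le_of_forall_gt_imp_ge_of_dense fun a ha => ?_
  have ha0 : 0 < a := lt_of_le_of_lt (mul_nonneg (by positivity) (apply_nonneg _ _)) ha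
  have h1 := h (((a⁻¹ : ℝ) : 𝕜) • x) (by
    rw [map_smul_eq_mul, RCLike.norm_ofReal, abs_of_pos (by positivity), inv_mul_lt_iff₀ ha0]
    rwa [inv_mul_lt_iff₀ hr, mul_comm] at ha)
  rwa [map_smul_eq_mul, RCLike.norm_ofReal, abs_of_pos (by positivity), inv_mul_le_iff₀ ha0,
    mul_one] at h1

/-- Hahn-Banach: the functional `c v ↦ c p_α(v)` on the line through `v` is dominated by `p_α`. -/
theorem WithSeminorms.exists_strongDual_apply_eq {E A : Type*} [AddCommGroup E] [Module 𝕜 E]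
    [TopologicalSpace E] [IsTopologicalAddGroup E] {p : SeminormFamily 𝕜 E A}
    (hp : WithSeminorms p) (α : A) (v : E) :
    ∃ e : E →L[𝕜] 𝕜, (∀ w, ‖e w‖ ≤ p α w) ∧ e v = (p α v : 𝕜) := by
  by_cases hv : v = 0
  · exact ⟨0, fun w => by simp, by simp [hv]⟩
  have := hp.toPolynormableSpace
  let f : Module.Dual 𝕜 (𝕜 ∙ v) := (p α v : 𝕜) • (LinearEquiv.coord 𝕜 E v hv).toLinearMap
  have hf : ∀ c : 𝕜, ∀ h : c • v ∈ 𝕜 ∙ v, f ⟨c • v, h⟩ = p α v * c := fun c h => by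
    have h1 : (⟨c • v, h⟩ : 𝕜 ∙ v) = c • ⟨v, Submodule.mem_span_singleton_self v⟩ := rfl
    change (p α v : 𝕜) * LinearEquiv.coord 𝕜 E v hv ⟨c • v, h⟩ = _
    rw [h1, map_smul, LinearEquiv.coord_self, smul_eq_mul, mul_one]
  obtain ⟨e, he, hle⟩ := Module.Dual.exists_continuous_extension_of_le_seminorm (𝕜 ∙ v) f
    (hp.continuous_seminorm α) (by
      rintro ⟨w, hw⟩
      obtain ⟨c, rfl⟩ := Submodule.mem_span_singleton.1 hw
      rw [hf, norm_mul, RCLike.norm_ofReal, abs_of_nonneg (apply_nonneg _ _), map_smul_eq_mul,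
        mul_comm])
  refine ⟨e, hle, ?_⟩
  have h1 := he ⟨(1 : 𝕜) • v, Submodule.smul_mem _ _ (Submodule.mem_span_singleton_self v)⟩
  rw [hf] at h1
  simpa using h1

variable {X : Type*} [AddCommGroup X] [Module 𝕜 X] [TopologicalSpace X]

theorem absConvexCompacts_nonempty : (absConvexCompacts 𝕜 X).Nonempty :=
  ⟨∅, fun _ h => h.elim, isCompact_empty⟩

omit [TopologicalSpace X] in
theorem IsAbsolutelyConvex.zero_mem {K : Set X} (hK : IsAbsolutelyConvex 𝕜 K) (h : K.Nonempty) :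
    (0 : X) ∈ K := by
  obtain ⟨x, hx⟩ := h
  simpa using hK x hx x hx 0 0 (by simp)

open Pointwise in
-- Needed so that single sets of the family index a basis at zero. `K + L` contains `K` and `L`
-- because each contains `0`; the empty set, which also belongs to the family, is treated apart.
theorem directedOn_absConvexCompacts [IsTopologicalAddGroup X] :
    DirectedOn (· ⊆ ·) (absConvexCompacts 𝕜 X) := by
  rintro K ⟨hK, hKc⟩ L ⟨hL, hLc⟩
  rcases K.eq_empty_or_nonempty with rfl | hK0
  · exact ⟨L, ⟨hL, hLc⟩, empty_subset _, subset_rfl⟩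
  rcases L.eq_empty_or_nonempty with rfl | hL0
  · exact ⟨K, ⟨hK, hKc⟩, subset_rfl, empty_subset _⟩
  refine ⟨K + L, ⟨?_, hKc.add hLc⟩, fun x hx => ⟨x, hx, 0, hL.zero_mem hL0, add_zero x⟩,
    fun x hx => ⟨0, hK.zero_mem hK0, x, hx, zero_add x⟩⟩
  rintro _ ⟨x, hx, x', hx', rfl⟩ _ ⟨y, hy, y', hy', rfl⟩ a b hab
  refine ⟨a • x + b • y, hK x hx y hy a b hab, a • x' + b • y', hL x' hx' y' hy' a b hab, ?_⟩
  simp only [smul_add]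
  abel

theorem equicontinuousSets_nonempty : (equicontinuousSets 𝕜 X).Nonempty :=
  ⟨∅, fun _ _ _ => Eventually.of_forall fun _ y => y.2.elim⟩

theorem directedOn_equicontinuousSets : DirectedOn (· ⊆ ·) (equicontinuousSets 𝕜 X) := by
  intro H hH H' hH'
  refine ⟨H ∪ H', fun x U hU => ?_, subset_union_left, subset_union_right⟩
  filter_upwards [hH x U hU, hH' x U hU] with z hz hz' y
  rcases y with ⟨y, hy | hy⟩
  · exact hz ⟨y, hy⟩
  · exact hz' ⟨y, hy⟩

theorem mem_equicontinuousSets_of_le [IsTopologicalAddGroup X] {q : Seminorm 𝕜 X}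
    (hq : Continuous q) {H : Set (KappaDual 𝕜 X)} (h : ∀ y ∈ H, ∀ x, ‖y x‖ ≤ q x) :
    H ∈ equicontinuousSets 𝕜 X := by
  intro x U hU
  obtain ⟨ε, hε, hεU⟩ := Metric.mem_uniformity_dist.1 hU
  have hc : Continuous fun z => q (x - z) := hq.comp (continuous_const.sub continuous_id)
  have := hc.continuousAt (x := x) |>.eventually_lt continuousAt_const (by simpa using hε)
  filter_upwards [this] with z hz y
  refine hεU ?_
  rw [dist_eq_norm]
  have h1 := h y y.2 (x - z)
  rw [map_sub] at h1
  exact h1.trans_lt hz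

theorem singleton_mem_equicontinuousSets (y : KappaDual 𝕜 X) :
    {y} ∈ equicontinuousSets 𝕜 X := by
  intro x U hU
  have hc : Continuous fun z => y z := map_continuous y
  filter_upwards [hc.continuousAt (x := x) (UniformSpace.ball_mem_nhds _ hU)] with z hz y'
  rw [show (y' : KappaDual 𝕜 X) = y from y'.2]
  exact hz

theorem sUnion_equicontinuousSets : ⋃₀ equicontinuousSets 𝕜 X = univ :=
  eq_univ_of_forall fun y => ⟨{y}, singleton_mem_equicontinuousSets y, rfl⟩

theorem sUnion_absConvexCompacts [ContinuousSMul 𝕜 X] : ⋃₀ absConvexCompacts 𝕜 X = univ :=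
  eq_univ_of_forall fun x => by
    obtain ⟨K, hK, hx⟩ := exists_mem_absConvexCompacts 𝕜 x
    exact ⟨K, hK, hx⟩

variable {E A : Type*} [AddCommGroup E] [Module 𝕜 E] [TopologicalSpace E]

/-- A continuous linear map on `X'_κ` is controlled on an absolutely convex compact set. -/
theorem exists_absConvexCompact_le [IsTopologicalAddGroup X] (u : EpsProduct 𝕜 X E) {q : Seminorm 𝕜 E} (hq : Continuous q) :
    ∃ K ∈ absConvexCompacts 𝕜 X, ∃ C : ℝ, 0 ≤ C ∧ ∀ (y : KappaDual 𝕜 X) (t : ℝ), 0 < t →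
      (∀ f ∈ K, ‖y f‖ ≤ t) → q (u y) ≤ C * t := by
  have hc : Continuous fun y : KappaDual 𝕜 X => q (u y) := hq.comp (map_continuous u)
  have h1 : ∀ᶠ y in 𝓝 (0 : KappaDual 𝕜 X), q (u y) < 1 :=
    hc.continuousAt.eventually_lt continuousAt_const (by simp)
  obtain ⟨⟨K, r⟩, ⟨hK, hr⟩, hKr⟩ := (UniformConvergenceCLM.hasBasis_nhds_zero_of_basis
    (RingHom.id 𝕜) 𝕜 (absConvexCompacts 𝕜 X) absConvexCompacts_nonempty
    directedOn_absConvexCompacts Metric.nhds_basis_closedBall).mem_iff.1 h1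
  -- Scaling `y` by `r / t` brings it into the neighbourhood where `q ∘ u < 1`; this is the origin
  -- of `C = r⁻¹`.
  refine ⟨K, hK, r⁻¹, by positivity, fun y t ht hy => ?_⟩
  have hrt : 0 < r * t⁻¹ := mul_pos hr (inv_pos.2 ht)
  have h2 : q (u (((r * t⁻¹ : ℝ) : 𝕜) • y)) < 1 := hKr fun f hf => by
    rw [mem_closedBall_zero_iff]
    change ‖((r * t⁻¹ : ℝ) : 𝕜) * y f‖ ≤ r
    rw [norm_mul, RCLike.norm_ofReal, abs_of_pos hrt, mul_assoc]
    refine mul_le_of_le_one_right hr.le ?_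
    rw [inv_mul_le_one₀ ht]
    exact hy f hf
  rw [map_smul, map_smul_eq_mul, RCLike.norm_ofReal, abs_of_pos hrt, mul_assoc,
    ← lt_inv_mul_iff₀ hr, mul_one, inv_mul_lt_iff₀ ht, mul_comm] at h2
  exact h2.le

theorem continuous_of_absConvexCompact_le [IsTopologicalAddGroup X] [IsTopologicalAddGroup E]
    {p : SeminormFamily 𝕜 E A} (hp : WithSeminorms p) (u : KappaDual 𝕜 X →ₗ[𝕜] E)
    (h : ∀ α, ∃ K ∈ absConvexCompacts 𝕜 X, ∀ (y : KappaDual 𝕜 X) (t : ℝ), 0 < t →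
      (∀ f ∈ K, ‖y f‖ ≤ t) → p α (u y) ≤ t) : Continuous u := by
  refine continuous_of_continuousAt_zero u ?_
  rw [ContinuousAt, map_zero, hp.tendsto_nhds]
  intro α ε hε
  obtain ⟨K, hK, hu⟩ := h α
  filter_upwards [UniformConvergenceCLM.eventually_nhds_zero_mapsTo (RingHom.id 𝕜) hK
    (Metric.closedBall_mem_nhds (0 : 𝕜) (half_pos hε))] with y hy
  rw [sub_zero]
  exact (hu y _ (half_pos hε) fun f hf => mem_closedBall_zero_iff.1 (hy hf)).trans_lt
    (half_lt_self hε)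

theorem continuous_eval_epsProduct [IsTopologicalAddGroup E] (y : KappaDual 𝕜 X) :
    Continuous fun u : EpsProduct 𝕜 X E => u y := by
  have := UniformConvergenceCLM.continuousEvalConst (RingHom.id 𝕜) E (equicontinuousSets 𝕜 X)
    sUnion_equicontinuousSets
  exact continuous_eval_const y

theorem t2Space_epsProduct [IsTopologicalAddGroup E] [T2Space E] : T2Space (EpsProduct 𝕜 X E) :=
  UniformConvergenceCLM.t2Space (RingHom.id 𝕜) E (equicontinuousSets 𝕜 X) sUnion_equicontinuousSets

end General

/-! ### Equicontinuous sets, point evaluations and the approximation property: statement (d) -/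

theorem IsLocallyBoundedAwayFromZero.nonempty {Ω J : Type*} [TopologicalSpace Ω]
    {ν : J → Ω → ℝ≥0} (haway : IsLocallyBoundedAwayFromZero ν) : Nonempty J := by
  obtain ⟨j, -⟩ := haway ∅ isCompact_empty
  exact ⟨j⟩

theorem IsWeightFamily.exists_forall_mem_le {Ω J : Type*} [Nonempty J] {ν : J → Ω → ℝ≥0}
    (hν : IsWeightFamily ν) (I : Finset J) :
    ∃ (j : J) (C : ℝ≥0), ∀ i ∈ I, ∀ x, ν i x ≤ C * ν j x := by
  classical
  induction I using Finset.induction_on with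
  | empty => exact ⟨Classical.arbitrary J, 0, by simp⟩
  | insert i I _ ih =>
    obtain ⟨j, C, h⟩ := ih
    obtain ⟨k, D, -, hi, hj⟩ := hν.directed i j
    refine ⟨k, max D (C * D), fun l hl x => ?_⟩
    rcases Finset.mem_insert.1 hl with rfl | hl
    · exact (hi x).trans (by gcongr; exact le_max_left _ _)
    · calc ν l x ≤ C * (D * ν k x) := (h l hl x).trans (by gcongr; exact hj x)
        _ = (C * D) * ν k x := (mul_assoc _ _ _).symm
        _ ≤ _ := by gcongr; exact le_max_right _ _

section

variable {𝕜 Ω J : Type*} [RCLike 𝕜] [TopologicalSpace Ω] [T2Space Ω] {ν : J → Ω → ℝ≥0}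

open CVZero

/-- Equicontinuous subsets of `CV⁰₀(Ω)'` are bounded by one of the defining seminorms. -/
theorem exists_seminorms_le_of_mem_equicontinuousSets [Nonempty J] (hν : IsWeightFamily ν)
    {H : Set (KappaDual 𝕜 (CVZeroScalar 𝕜 ν))} (hH : H ∈ equicontinuousSets 𝕜 (CVZeroScalar 𝕜 ν)) :
    ∃ (j : J) (C : ℝ), 0 ≤ C ∧ ∀ y ∈ H, ∀ f, ‖y f‖ ≤ C * seminorms ν (scalarSeminorms 𝕜) (j, ()) f := by
  have h := hH 0 _ (Metric.dist_mem_uniformity one_pos)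
  obtain ⟨I, r, hr, hI⟩ :=
    ((withSeminorms ν (scalarSeminorms 𝕜)).mem_nhds_iff 0 _).1 h
  classical
  -- Directedness replaces the finite supremum of seminorms by a multiple of one of them.
  obtain ⟨j, C, hC⟩ := hν.exists_forall_mem_le (I.image Prod.fst)
  have hsup : ∀ f, (I.sup (seminorms ν (scalarSeminorms 𝕜))) f ≤
      C * seminorms ν (scalarSeminorms 𝕜) (j, ()) f := fun f => by
    have h0 : 0 ≤ C * seminorms ν (scalarSeminorms 𝕜) (j, ()) f :=
      mul_nonneg C.2 (apply_nonneg _ _)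
    refine Seminorm.finset_sup_apply_le h0 fun i hi => (seminorms_le_iff h0).2 fun x => ?_
    calc scalarSeminorms 𝕜 i.2 (f x) * ν i.1 x
        ≤ scalarSeminorms 𝕜 () (f x) * (C * ν j x) := by
          gcongr
          exact_mod_cast hC i.1 (Finset.mem_image_of_mem _ hi) x
      _ = C * (scalarSeminorms 𝕜 () (f x) * ν j x) := by ring
      _ ≤ _ := by
          gcongr
          exact apply_mul_le_seminorms f j () x
  refine ⟨j, r⁻¹ * C, by positivity, fun y hy f => ?_⟩
  have := Seminorm.le_mul_of_forall_lt (q₂ := (normSeminorm 𝕜 𝕜).comp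
    ((y : CVZeroScalar 𝕜 ν →L[𝕜] 𝕜) : CVZeroScalar 𝕜 ν →ₗ[𝕜] 𝕜)) hr (fun f hf => by
      have hf' : f ∈ (I.sup (seminorms ν (scalarSeminorms 𝕜))).ball 0 r := by
        rwa [Seminorm.mem_ball, sub_zero]
      have h1 := hI hf' ⟨y, hy⟩
      have h2 : dist (y 0) (y f) < 1 := h1
      rw [map_zero, dist_zero_left] at h2
      exact h2.le) f
  rw [mul_assoc]
  exact this.trans (by gcongr; exact hsup f)

variable [LocallyCompactSpace Ω]

/-- Continuity into `F'_κ` amounts to equicontinuity of each absolutely convex compact set of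
functions. -/
theorem continuous_evalDelta (hν : IsWeightFamily ν) (haway : IsLocallyBoundedAwayFromZero ν) :
    Continuous (evalDelta 𝕜 hν) := by
  refine continuous_iff_continuousAt.2 fun x₀ => ?_
  rw [ContinuousAt, UniformConvergenceCLM.tendsto_iff_tendstoUniformlyOn]
  intro K hK
  rw [Metric.tendstoUniformlyOn_iff]
  intro ε hε
  filter_upwards [eventually_forall_mem_of_isCompact (withSeminorms_scalarSeminorms 𝕜) haway
    hK.2 () x₀ (half_pos hε)] with x hx f hf
  rw [dist_comm, dist_eq_norm]
  exact (hx f hf).trans_lt (half_lt_self hε)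

/-- The operators `f ↦ ∑ f(xᵢ) φᵢ` on `CV⁰₀(Ω)`. -/
def pointOperators (𝕜 : Type*) [RCLike 𝕜] {ν : J → Ω → ℝ≥0} :
    Set (KappaMaps 𝕜 (CVZeroScalar 𝕜 ν) (CVZeroScalar 𝕜 ν)) :=
  {T | ∃ (s : Finset Ω) (φ : s → CVZeroScalar 𝕜 ν), ∀ f, T f = ∑ i : s, f i • φ i}

/-- A compact set of functions is equicontinuous and uniformly small at infinity, so one partition
of unity serves all its members, and the approximant is linear in `f`. The special form of the
operators, beyond finite rank, matters for the transpose identity. -/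
theorem id_mem_closure_pointOperators (hν : IsWeightFamily ν)
    (hbdd : IsLocallyBoundedFamily ν) (haway : IsLocallyBoundedAwayFromZero ν) :
    UniformConvergenceCLM.ofFun (RingHom.id 𝕜) (CVZeroScalar 𝕜 ν)
      (absConvexCompacts 𝕜 (CVZeroScalar 𝕜 ν)) (ContinuousLinearMap.id 𝕜 (CVZeroScalar 𝕜 ν)) ∈
    closure (pointOperators 𝕜 (ν := ν)) := by
  set i₀ := UniformConvergenceCLM.ofFun (RingHom.id 𝕜) (CVZeroScalar 𝕜 ν)
      (absConvexCompacts 𝕜 (CVZeroScalar 𝕜 ν)) (ContinuousLinearMap.id 𝕜 (CVZeroScalar 𝕜 ν))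
  refine mem_closure_iff_nhds.2 fun U hU => ?_
  have hU' : (fun D => i₀ - D) ⁻¹' U ∈ 𝓝 0 :=
    (continuous_const.sub continuous_id).continuousAt.preimage_mem_nhds (by simpa using hU)
  obtain ⟨⟨K, I, r⟩, ⟨hK, hr⟩, hKU⟩ := (UniformConvergenceCLM.hasBasis_nhds_zero_of_basis
    (RingHom.id 𝕜) (CVZeroScalar 𝕜 ν) (absConvexCompacts 𝕜 _) absConvexCompacts_nonempty
    directedOn_absConvexCompacts
    (withSeminorms ν (scalarSeminorms 𝕜)).hasBasis_zero_ball).mem_iff.1 hU'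
  dsimp only at hr hKU hK
  have hr4 : 0 < r / 4 := by positivity
  choose L hL hKL using fun i : J × Unit =>
    exists_isCompact_forall_apply_mul_le hK.2 i.1 i.2 hr4
  obtain ⟨s, φ, -, h⟩ := exists_partition_approx (𝕜 := 𝕜) I (fun i => scalarSeminorms 𝕜 i.2)
    (fun i => ν i.1) (fun K hK i => hbdd K hK i.1)
    (B := (fun f : CVZeroScalar 𝕜 ν => (f : Ω → 𝕜)) '' K) (fun i _ x₀ δ hδ => by
      filter_upwards [eventually_forall_mem_of_isCompact (withSeminorms_scalarSeminorms 𝕜) haway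
        hK.2 i.2 x₀ hδ] with x hx
      rintro _ ⟨f, hf, rfl⟩
      exact hx f hf) (L := ⋃ i ∈ I, L i) (I.isCompact_biUnion fun i _ => hL i) isOpen_univ
    (subset_univ _) hr4 (fun i hi => by
      rintro _ ⟨f, hf, rfl⟩ x hx
      exact hKL i f hf x fun hxi => hx (mem_iUnion₂.2 ⟨i, hi, hxi⟩))
  let ψ : s → CVZeroScalar 𝕜 ν := fun i => mk (φ i).toContinuousMap
    (mem_weightedSubmodule₀_of_hasCompactSupport
      (withSeminorms_scalarSeminorms 𝕜).continuous_seminorm hbdd (φ i).hasCompactSupport)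
  let T : CVZeroScalar 𝕜 ν →L[𝕜] CVZeroScalar 𝕜 ν :=
    { toFun := fun f => ∑ i : s, f i • ψ i
      map_add' := fun f g => by simp only [CVZero.add_apply, add_smul, Finset.sum_add_distrib]
      map_smul' := fun c f => by
        simp only [CVZero.smul_apply, smul_assoc, Finset.smul_sum, RingHom.id_apply]
      cont := continuous_finsetSum _ fun i _ =>
        (continuous_eval (withSeminorms_scalarSeminorms 𝕜) hν i).smul continuous_const }
  refine ⟨UniformConvergenceCLM.ofFun (RingHom.id 𝕜) (CVZeroScalar 𝕜 ν)
      (absConvexCompacts 𝕜 (CVZeroScalar 𝕜 ν)) T, ?_, s, ψ, fun f => rfl⟩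
  have hD := @hKU (i₀ - UniformConvergenceCLM.ofFun (RingHom.id 𝕜) (CVZeroScalar 𝕜 ν)
      (absConvexCompacts 𝕜 (CVZeroScalar 𝕜 ν)) T) fun f hf => by
    rw [Seminorm.mem_ball, sub_zero]
    refine Seminorm.finset_sup_apply_lt hr fun i hi => ?_
    refine lt_of_le_of_lt ((seminorms_le_iff (M := 2 * (r / 4)) (by positivity)).2
      fun x => ?_) (by linarith)
    refine le_trans (le_of_eq ?_) (h i hi _ (mem_image_of_mem _ hf) x)
    congr 2
    change (f - ∑ i : s, f i • ψ i) x = _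
    rw [CVZero.sub_apply, CVZero.sum_apply]
    congr 1
    exact Finset.sum_congr rfl fun i _ => mul_comm _ _
  simpa using hD

theorem hasApproximationProperty_cvZeroScalar (hν : IsWeightFamily ν)
    (hbdd : IsLocallyBoundedFamily ν) (haway : IsLocallyBoundedAwayFromZero ν) :
    HasApproximationProperty 𝕜 (CVZeroScalar 𝕜 ν) := by
  refine closure_mono ?_ (id_mem_closure_pointOperators hν hbdd haway)
  rintro T ⟨s, φ, hT⟩
  refine ⟨Submodule.span 𝕜 (range φ), FiniteDimensional.span_of_finite 𝕜 (finite_range φ),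
    fun f => ?_⟩
  rw [hT]
  exact Submodule.sum_mem _ fun i _ => Submodule.smul_mem _ _ (Submodule.subset_span ⟨i, rfl⟩)

end

/-! ### The map `u ↦ (x ↦ u(δ_x))` as a topological embedding -/

section

open CVZero

variable {𝕜 Ω E J A : Type*} [RCLike 𝕜] [TopologicalSpace Ω] [T2Space Ω] [LocallyCompactSpace Ω]
  [AddCommGroup E] [Module 𝕜 E] [TopologicalSpace E] [IsTopologicalAddGroup E]
  [ContinuousSMul 𝕜 E] {p : SeminormFamily 𝕜 E A} {ν : J → Ω → ℝ≥0}

/-- Continuity of `u` on `F'_κ`, applied to `ν_j(x) δ_x`, bounds `p_α(u(δ_x)) ν_j(x)` through the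
values `|f(x)| ν_j(x)`, `f ∈ K`, for a compact `K ⊆ F`; these are bounded and uniformly small at
infinity. -/
theorem evalDelta_comp_mem (hp : WithSeminorms p) (hν : IsWeightFamily ν)
    (haway : IsLocallyBoundedAwayFromZero ν) (u : EpsProduct 𝕜 (CVZeroScalar 𝕜 ν) E) :
    (⟨fun x => u (evalDelta 𝕜 hν x), (map_continuous u).comp (continuous_evalDelta hν haway)⟩ :
      C(Ω, E)) ∈ weightedSubmodule₀ ν p := by
  refine mem_weightedSubmodule₀_iff.2 fun j α => ?_
  obtain ⟨K, hK, C, hC, h⟩ := exists_absConvexCompact_le u (hp.continuous_seminorm α)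
  have key : ∀ x (t : ℝ), 0 < t → (∀ f ∈ K, ‖f x‖ * ν j x ≤ t) →
      p α (u (evalDelta 𝕜 hν x)) * ν j x ≤ C * t := fun x t ht hx => by
    have h1 := h (((ν j x : ℝ) : 𝕜) • evalDelta 𝕜 hν x) t ht fun f hf => by
      change ‖((ν j x : ℝ) : 𝕜) * f x‖ ≤ t
      rw [norm_mul, RCLike.norm_ofReal, NNReal.abs_eq, mul_comm]
      exact hx f hf
    rwa [map_smul, map_smul_eq_mul, RCLike.norm_ofReal, NNReal.abs_eq, mul_comm] at h1
  constructor
  · obtain ⟨M, hM⟩ := hK.2.bddAbove_image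
      ((withSeminorms ν (scalarSeminorms 𝕜)).continuous_seminorm (j, ())).continuousOn
    -- `key` needs a positive bound, hence `max M 1`.
    refine ⟨C * max M 1, fun x => key x _ (by positivity) fun f hf => ?_⟩
    exact (apply_mul_le_seminorms f j () x).trans
      ((hM (mem_image_of_mem _ hf)).trans (le_max_left _ _))
  · intro ε hε
    have hε' : 0 < ε / (C + 1) := by positivity
    obtain ⟨L, hL, hKL⟩ := exists_isCompact_forall_apply_mul_le hK.2 j () hε'
    refine ⟨L, hL, fun x hx => (key x _ hε' fun f hf => hKL f hf x hx).trans ?_⟩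
    rw [mul_div_assoc', div_le_iff₀ (by positivity)]
    nlinarith

/-- The map `u ↦ (x ↦ u(δ_x))` from `CV⁰₀(Ω) ε E` to `CV⁰₀(Ω, E)`. -/
noncomputable def epsEval (hp : WithSeminorms p) (hν : IsWeightFamily ν)
    (haway : IsLocallyBoundedAwayFromZero ν) :
    EpsProduct 𝕜 (CVZeroScalar 𝕜 ν) E →ₗ[𝕜] CVZero ν p where
  toFun u := CVZero.mk _ (evalDelta_comp_mem hp hν haway u)
  map_add' _ _ := rfl
  map_smul' _ _ := rfl

theorem epsEval_apply (hp : WithSeminorms p) (hν : IsWeightFamily ν)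
    (haway : IsLocallyBoundedAwayFromZero ν) (u : EpsProduct 𝕜 (CVZeroScalar 𝕜 ν) E) (x : Ω) :
    epsEval hp hν haway u x = u (evalDelta 𝕜 hν x) := rfl

/-- The functionals `ν_j(x) δ_x`, `x ∈ Ω`, are bounded by `|·|_j`, hence equicontinuous, and
`|S(u)|_{j,α}` is the supremum of `p_α ∘ u` over them. -/
theorem continuous_epsEval (hp : WithSeminorms p) (hν : IsWeightFamily ν)
    (haway : IsLocallyBoundedAwayFromZero ν) : Continuous (epsEval hp hν haway) := by
  refine continuous_of_continuousAt_zero (epsEval hp hν haway) ?_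
  rw [ContinuousAt, map_zero, (withSeminorms ν p).tendsto_nhds]
  rintro ⟨j, α⟩ ε hε
  let H : Set (KappaDual 𝕜 (CVZeroScalar 𝕜 ν)) :=
    range fun x => ((ν j x : ℝ) : 𝕜) • evalDelta 𝕜 hν x
  have hnorm : ∀ x, ‖((ν j x : ℝ) : 𝕜)‖ = ν j x := fun x => by
    rw [RCLike.norm_ofReal, NNReal.abs_eq]
  have hH : H ∈ equicontinuousSets 𝕜 (CVZeroScalar 𝕜 ν) := by
    refine mem_equicontinuousSets_of_le
      ((withSeminorms ν (scalarSeminorms 𝕜)).continuous_seminorm (j, ())) ?_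
    rintro _ ⟨x, rfl⟩ f
    change ‖((ν j x : ℝ) : 𝕜) * f x‖ ≤ _
    rw [norm_mul, hnorm, mul_comm]
    exact apply_mul_le_seminorms f j () x
  have hV : {v | p α v < ε / 2} ∈ 𝓝 (0 : E) :=
    (hp.continuous_seminorm α).continuousAt.eventually_lt continuousAt_const
      (by simpa using half_pos hε)
  filter_upwards [UniformConvergenceCLM.eventually_nhds_zero_mapsTo (RingHom.id 𝕜) hH hV] with u hu
  rw [sub_zero]
  refine lt_of_le_of_lt ((seminorms_le_iff (half_pos hε).le).2 fun x => ?_) (half_lt_self hε)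
  have h1 : p α (u (((ν j x : ℝ) : 𝕜) • evalDelta 𝕜 hν x)) < ε / 2 := hu ⟨x, rfl⟩
  rw [map_smul, map_smul_eq_mul, hnorm, mul_comm] at h1
  exact h1.le

/-- The transpose identity `e(u(y)) = y(e ∘ S(u))`. -/
theorem apply_eq_apply_compScalar_epsEval (hp : WithSeminorms p) (hν : IsWeightFamily ν)
    (hbdd : IsLocallyBoundedFamily ν) (haway : IsLocallyBoundedAwayFromZero ν)
    (u : EpsProduct 𝕜 (CVZeroScalar 𝕜 ν) E) (y : KappaDual 𝕜 (CVZeroScalar 𝕜 ν))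
    (e : E →L[𝕜] 𝕜) (α : A) (he : ∀ v, ‖e v‖ ≤ p α v) :
    e (u y) = y (compScalar e α he (epsEval hp hν haway u)) := by
  let F := CVZeroScalar 𝕜 ν
  let Φ : KappaMaps 𝕜 F F →L[𝕜] KappaDual 𝕜 F :=
    ContinuousLinearMap.postcompUniformConvergenceCLM (absConvexCompacts 𝕜 F) (y : F →L[𝕜] 𝕜)
  have := UniformConvergenceCLM.continuousEvalConst (RingHom.id 𝕜) F (absConvexCompacts 𝕜 F)
    sUnion_absConvexCompacts
  set g := compScalar e α he (epsEval hp hν haway u) with hg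
  -- With `y` replaced by `y ∘ T`, both sides are continuous in `T`. The case `T = id` is the claim,
  -- and it follows from that of the point operators, for which `y ∘ T = ∑ y(φᵢ) δ_{xᵢ}`.
  have hcl : IsClosed {T : KappaMaps 𝕜 F F | e (u (Φ T)) = y (T g)} :=
    isClosed_eq (e.continuous.comp ((map_continuous u).comp Φ.continuous))
      ((map_continuous y).comp (continuous_eval_const g))
  refine closure_minimal (s := pointOperators 𝕜) ?_ hcl (id_mem_closure_pointOperators hν hbdd haway)
  rintro T ⟨s, φ, hT⟩
  have hΦ : Φ T = ∑ i : s, y (φ i) • evalDelta 𝕜 hν i := by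
    ext f
    have h1 : (∑ i : s, y (φ i) • evalDelta 𝕜 hν i) f = ∑ i : s, y (φ i) * f i := by
      rw [_root_.sum_apply]
      rfl
    rw [h1]
    change y (T f) = _
    rw [hT, map_sum]
    exact Finset.sum_congr rfl fun i _ => by rw [map_smul, smul_eq_mul, mul_comm]
  change e (u (Φ T)) = y (T g)
  rw [hΦ, hT, map_sum, map_sum, map_sum]
  refine Finset.sum_congr rfl fun i _ => ?_
  rw [map_smul, map_smul, map_smul, smul_eq_mul, smul_eq_mul, mul_comm]
  rfl

theorem seminorm_apply_le_of_epsEval (hp : WithSeminorms p) (hν : IsWeightFamily ν)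
    (hbdd : IsLocallyBoundedFamily ν) (haway : IsLocallyBoundedAwayFromZero ν)
    (u : EpsProduct 𝕜 (CVZeroScalar 𝕜 ν) E) (y : KappaDual 𝕜 (CVZeroScalar 𝕜 ν))
    {j : J} {C : ℝ} (hC : 0 ≤ C)
    (hy : ∀ f, ‖y f‖ ≤ C * seminorms ν (scalarSeminorms 𝕜) (j, ()) f) (α : A) :
    p α (u y) ≤ C * seminorms ν p (j, α) (epsEval hp hν haway u) := by
  obtain ⟨e, he, heq⟩ := hp.exists_strongDual_apply_eq α (u y)
  have h1 : p α (u y) = ‖e (u y)‖ := by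
    rw [heq, RCLike.norm_ofReal, abs_of_nonneg (apply_nonneg _ _)]
  rw [h1, apply_eq_apply_compScalar_epsEval hp hν hbdd haway u y e α he]
  exact (hy _).trans (mul_le_mul_of_nonneg_left (seminorms_compScalar_le e α he _ j) hC)

/-- An equicontinuous set of functionals is bounded by some `C |·|_j`, so uniform smallness of `u`
on it follows from smallness of `C |S(u)|_{j,α}` for finitely many `α`. -/
theorem isInducing_epsEval (hp : WithSeminorms p) (hν : IsWeightFamily ν)
    (hbdd : IsLocallyBoundedFamily ν) (haway : IsLocallyBoundedAwayFromZero ν) :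
    IsInducing (epsEval hp hν haway) := by
  have := haway.nonempty
  refine IsTopologicalAddGroup.isInducing_iff_nhds_zero.2 (le_antisymm ?_ ?_)
  · rw [← map_le_iff_le_comap]
    have h := (continuous_epsEval hp hν haway).tendsto 0
    rwa [map_zero] at h
  · intro U hU
    obtain ⟨⟨H, I, r⟩, ⟨hH, hr⟩, hHU⟩ := (UniformConvergenceCLM.hasBasis_nhds_zero_of_basis
      (RingHom.id 𝕜) E (equicontinuousSets 𝕜 (CVZeroScalar 𝕜 ν)) equicontinuousSets_nonempty
      directedOn_equicontinuousSets hp.hasBasis_zero_ball).mem_iff.1 hU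
    dsimp only at hH hr hHU
    obtain ⟨j, C, hC, hb⟩ := exists_seminorms_le_of_mem_equicontinuousSets hν hH
    have hev : ∀ᶠ g in 𝓝 (0 : CVZero ν p), ∀ α ∈ I, C * seminorms ν p (j, α) g < r :=
      I.eventually_all.2 fun α _ => by
        refine (((withSeminorms ν p).continuous_seminorm (j, α)).const_mul C).continuousAt.eventually_lt
          continuousAt_const ?_
        simpa using hr
    refine mem_of_superset (preimage_mem_comap hev) fun u hu => hHU fun y hy => ?_
    rw [Seminorm.mem_ball, sub_zero]
    exact Seminorm.finset_sup_apply_lt hr fun α hα =>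
      (seminorm_apply_le_of_epsEval hp hν hbdd haway u y hC (hb y hy) α).trans_lt (hu α hα)

end

/-! ### Extension by density and completions -/

section

variable {𝕜 : Type*} [RCLike 𝕜]

/-- For additive groups with their group uniformities, inducing implies uniformly inducing, so the
extension theorem for uniform spaces applies; `i` need not be injective. -/
theorem exists_continuousLinearMap_extension {M X E : Type*} [AddCommGroup M] [Module 𝕜 M]
    [UniformSpace M] [IsUniformAddGroup M] [AddCommGroup X] [Module 𝕜 X] [TopologicalSpace X]
    [IsTopologicalAddGroup X] [ContinuousConstSMul 𝕜 X] [AddCommGroup E] [Module 𝕜 E]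
    [UniformSpace E] [IsUniformAddGroup E] [ContinuousConstSMul 𝕜 E] [T0Space E] [CompleteSpace E]
    {i : M →ₗ[𝕜] X} (hi : IsInducing i) (hd : DenseRange i) (f : M →L[𝕜] E) :
    ∃ g : X →L[𝕜] E, ∀ m, g (i m) = f m := by
  let : UniformSpace X := IsTopologicalAddGroup.rightUniformSpace X
  have : IsUniformAddGroup X := isUniformAddGroup_of_addCommGroup
  have h : IsUniformInducing i := AddMonoidHom.isUniformInducing_of_isInducing hi
  exact ⟨f.extend ⟨i, hi.continuous⟩, fun m =>
    ContinuousLinearMap.extend_eq f (e := ⟨i, hi.continuous⟩) hd h m⟩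

/-- The two canonical maps out of `M` extend to each other's targets, and the extensions are
mutually inverse because they are so on dense images. -/
theorem exists_continuousLinearEquiv_completion {M X : Type*} [AddCommGroup M] [Module 𝕜 M]
    [UniformSpace M] [IsUniformAddGroup M] [UniformContinuousConstSMul 𝕜 M] [AddCommGroup X]
    [Module 𝕜 X] [UniformSpace X] [IsUniformAddGroup X] [ContinuousConstSMul 𝕜 X] [T2Space X]
    [CompleteSpace X] {i : M →ₗ[𝕜] X} (hi : IsUniformInducing i) (hd : DenseRange i) :
    ∃ T : X ≃L[𝕜] UniformSpace.Completion M, ∀ m, T (i m) = m := by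
  let c : M →ₗ[𝕜] UniformSpace.Completion M :=
    { UniformSpace.Completion.toCompl with map_smul' := UniformSpace.Completion.coe_smul }
  obtain ⟨f, hf⟩ := exists_continuousLinearMap_extension hi.isInducing hd
    (⟨c, UniformSpace.Completion.continuous_coe M⟩ : M →L[𝕜] UniformSpace.Completion M)
  obtain ⟨g, hg⟩ := exists_continuousLinearMap_extension (i := c)
    (UniformSpace.Completion.isUniformInducing_coe M).isInducing
    UniformSpace.Completion.denseRange_coe (⟨i, hi.isInducing.continuous⟩ : M →L[𝕜] X)
  have h1 : ⇑g ∘ ⇑f = id := hd.equalizer (g.continuous.comp f.continuous) continuous_id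
    (funext fun m => (congrArg g (hf m)).trans (hg m))
  have h2 : ⇑f ∘ ⇑g = id := UniformSpace.Completion.denseRange_coe.equalizer
    (f.continuous.comp g.continuous) continuous_id
    (funext fun m => (congrArg f (hg m)).trans (hf m))
  exact ⟨ContinuousLinearEquiv.equivOfInverse f g (congrFun h1) (congrFun h2), hf⟩

theorem Cauchy.exists_mem_forall_seminorm_sub_lt {X : Type*} [AddCommGroup X] [Module 𝕜 X]
    [UniformSpace X] [IsUniformAddGroup X] {𝓕 : Filter X} (h : Cauchy 𝓕) {q : Seminorm 𝕜 X}
    (hq : Continuous q) {ε : ℝ} (hε : 0 < ε) :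
    ∃ B ∈ 𝓕, ∀ f ∈ B, ∀ g ∈ B, q (f - g) < ε := by
  have hV : {z : X × X | q (z.2 - z.1) < ε} ∈ uniformity X := by
    rw [uniformity_eq_comap_nhds_zero]
    refine preimage_mem_comap (t := {f | q f < ε}) ?_
    exact hq.continuousAt.eventually_lt continuousAt_const (by simpa using hε)
  obtain ⟨B, hB, hBV⟩ := (cauchy_iff.1 h).2 _ hV
  exact ⟨B, hB, fun f hf g hg => hBV (mk_mem_prod hg hf)⟩

end

/-! ### Completeness of `CV⁰₀(Ω, E)` and compactness of dominated sets -/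

namespace CVZero

variable {𝕜 Ω E J A : Type*} [RCLike 𝕜] [TopologicalSpace Ω] [T2Space Ω]
  [AddCommGroup E] [Module 𝕜 E] {ν : J → Ω → ℝ≥0} {p : SeminormFamily 𝕜 E A}

omit [T2Space Ω] in
theorem isUniformAddGroup_continuousMap [UniformSpace E] [IsUniformAddGroup E] :
    IsUniformAddGroup C(Ω, E) := by
  let φ : C(Ω, E) →+ UniformOnFun Ω E {K | IsCompact K} :=
    ⟨⟨ContinuousMap.toUniformOnFunIsCompact, rfl⟩, fun _ _ => rfl⟩
  exact ContinuousMap.isUniformEmbedding_toUniformOnFunIsCompact.isUniformInducing.isUniformAddGroup φ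

/-- A Cauchy filter converges in the compact-open topology, since `C(Ω, E)` is complete for locally
compact `Ω`. Pointwise limits in the weighted Cauchy estimates show that the limit lies in the space
and is attained in the weighted topology. -/
theorem completeSpace [LocallyCompactSpace Ω] [UniformSpace E] [IsUniformAddGroup E]
    [ContinuousSMul 𝕜 E] [CompleteSpace E] (hp : WithSeminorms p)
    (haway : IsLocallyBoundedAwayFromZero ν) :
    @CompleteSpace (CVZero ν p) (IsTopologicalAddGroup.rightUniformSpace _) := by
  let : UniformSpace (CVZero ν p) := IsTopologicalAddGroup.rightUniformSpace _
  have : IsUniformAddGroup (CVZero ν p) := isUniformAddGroup_of_addCommGroup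
  refine ⟨fun {𝓕} h𝓕 => ?_⟩
  have := h𝓕.1
  have := isUniformAddGroup_continuousMap (Ω := Ω) (E := E)
  have hu : UniformContinuous (toContinuousMap ν p) :=
    uniformContinuous_addMonoidHom_of_continuous (continuous_toContinuousMap hp haway)
  obtain ⟨g, hg⟩ := CompleteSpace.complete (h𝓕.map hu)
  have hpt : ∀ x, Tendsto (fun f : CVZero ν p => f x) 𝓕 (𝓝 (g x)) := fun x =>
    ((continuous_eval_const x).tendsto g).comp hg
  have key : ∀ (j : J) (α : A) (ε : ℝ), 0 < ε →
      ∃ B ∈ 𝓕, ∀ f ∈ B, ∀ x, p α (f x - g x) * ν j x ≤ ε := fun j α ε hε => by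
    obtain ⟨B, hB, hBV⟩ := h𝓕.exists_mem_forall_seminorm_sub_lt
      ((withSeminorms ν p).continuous_seminorm (j, α)) hε
    refine ⟨B, hB, fun f hf x => ?_⟩
    have ht : Tendsto (fun f' : CVZero ν p => p α (f x - f' x) * ν j x) 𝓕
        (𝓝 (p α (f x - g x) * ν j x)) :=
      (((hp.continuous_seminorm α).tendsto _).comp ((hpt x).const_sub (f x))).mul_const _
    refine le_of_tendsto ht (mem_of_superset hB fun f' hf' => ?_)
    exact (apply_mul_le_seminorms (f - f') j α x).trans (hBV f hf f' hf').le
  have tri : ∀ (f : CVZero ν p) j α x,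
      p α (g x) * ν j x ≤ p α (f x - g x) * ν j x + p α (f x) * ν j x := fun f j α x => by
    have h1 : p α (g x) ≤ p α (f x - g x) + p α (f x) := by
      have := map_sub_le_add (p α) (f x) (f x - g x)
      rw [sub_sub_cancel] at this
      linarith
    rw [← add_mul]
    gcongr
  have hmem : g ∈ weightedSubmodule₀ ν p := mem_weightedSubmodule₀_iff.2 fun j α => by
    constructor
    · obtain ⟨B, hB, h⟩ := key j α 1 one_pos
      obtain ⟨f, hf⟩ := Filter.nonempty_of_mem hB
      exact ⟨1 + seminorms ν p (j, α) f, fun x => (tri f j α x).trans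
        (add_le_add (h f hf x) (apply_mul_le_seminorms f j α x))⟩
    · intro ε hε
      obtain ⟨B, hB, h⟩ := key j α (ε / 2) (half_pos hε)
      obtain ⟨f, hf⟩ := Filter.nonempty_of_mem hB
      obtain ⟨K, hK, hfK⟩ := exists_isCompact_apply_mul_le f j α (half_pos hε)
      exact ⟨K, hK, fun x hx => (tri f j α x).trans
        ((add_le_add (h f hf x) (hfK x hx)).trans (add_halves ε).le)⟩
  refine ⟨mk g hmem, ?_⟩
  have ht : Tendsto id 𝓕 (𝓝 (mk g hmem)) := by
    rw [(withSeminorms ν p).tendsto_nhds]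
    rintro ⟨j, α⟩ ε hε
    obtain ⟨B, hB, h⟩ := key j α (ε / 2) (half_pos hε)
    exact mem_of_superset hB fun f hf => lt_of_le_of_lt
      ((seminorms_le_iff (half_pos hε).le).2 fun x => h f hf x) (half_lt_self hε)
  exact ht

variable [TopologicalSpace E] [IsTopologicalAddGroup E] [ContinuousSMul 𝕜 E]

/-- The scalar functions whose modulus and increments are bounded by those of `p_α ∘ g`. -/
def dominatedSet (g : CVZero ν p) (α : A) : Set (CVZeroScalar 𝕜 ν) :=
  {f | (∀ x, ‖f x‖ ≤ p α (g x)) ∧ ∀ x y, ‖f x - f y‖ ≤ p α (g x - g y)}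

theorem compScalar_mem_dominatedSet (g : CVZero ν p) (α : A) (e : E →L[𝕜] 𝕜)
    (he : ∀ v, ‖e v‖ ≤ p α v) : compScalar e α he g ∈ dominatedSet g α := by
  refine ⟨fun x => he _, fun x y => ?_⟩
  rw [compScalar_apply, compScalar_apply, ← map_sub]
  exact he _

theorem isAbsolutelyConvex_dominatedSet (g : CVZero ν p) (α : A) :
    IsAbsolutelyConvex 𝕜 (dominatedSet g α) := by
  have aux : ∀ (a b v w : 𝕜) (r : ℝ), ‖a‖ + ‖b‖ ≤ 1 → ‖v‖ ≤ r → ‖w‖ ≤ r → ‖a * v + b * w‖ ≤ r :=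
    fun a b v w r hab hv hw => by
      have hr : 0 ≤ r := (norm_nonneg v).trans hv
      calc ‖a * v + b * w‖ ≤ ‖a‖ * ‖v‖ + ‖b‖ * ‖w‖ := by
            simpa only [norm_mul] using norm_add_le (a * v) (b * w)
        _ ≤ ‖a‖ * r + ‖b‖ * r := by gcongr
        _ = (‖a‖ + ‖b‖) * r := (add_mul _ _ _).symm
        _ ≤ r := mul_le_of_le_one_left hr hab
  rintro f ⟨hf, hf'⟩ h ⟨hh, hh'⟩ a b hab
  refine ⟨fun x => aux a b _ _ _ hab (hf x) (hh x), fun x y => ?_⟩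
  have h1 : (a • f + b • h) x - (a • f + b • h) y = a * (f x - f y) + b * (h x - h y) := by
    change a * f x + b * h x - (a * f y + b * h y) = _
    ring
  rw [h1]
  exact aux a b _ _ _ hab (hf' x y) (hh' x y)

/-- An Arzelà-Ascoli argument. The bound on values gives pointwise limits along ultrafilters, and
the limit inherits both bounds, hence continuity and decay. Convergence is uniform with weights: `g`
dominates off a compact set, and on it the bound on increments reduces matters to finitely many
points. -/
theorem isCompact_dominatedSet (hp : WithSeminorms p) (hbdd : IsLocallyBoundedFamily ν)
    (g : CVZero ν p) (α : A) : IsCompact (dominatedSet g α) := by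
  refine isCompact_iff_ultrafilter_le_nhds.2 fun U hU => ?_
  rw [le_principal_iff] at hU
  have hlim : ∀ x, ∃ c : 𝕜, Tendsto (fun f : CVZeroScalar 𝕜 ν => f x) U (𝓝 c) := fun x => by
    obtain ⟨c, -, hc⟩ := isCompact_iff_ultrafilter_le_nhds.1
      (isCompact_closedBall (0 : 𝕜) (p α (g x))) (U.map fun f : CVZeroScalar 𝕜 ν => f x) (by
        rw [le_principal_iff]
        exact mem_map.2 (mem_of_superset hU fun f hf => mem_closedBall_zero_iff.2 (hf.1 x)))
    exact ⟨c, hc⟩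
  choose h hh using hlim
  have hgc : Continuous g := (toContinuousMap ν p g).continuous
  have h1 : ∀ x, ‖h x‖ ≤ p α (g x) := fun x =>
    le_of_tendsto (hh x).norm (mem_of_superset hU fun f hf => hf.1 x)
  have h2 : ∀ x y, ‖h x - h y‖ ≤ p α (g x - g y) := fun x y =>
    le_of_tendsto ((hh x).sub (hh y)).norm (mem_of_superset hU fun f hf => hf.2 x y)
  have hsub : ∀ x₀, Tendsto (fun x => p α (g x - g x₀)) (𝓝 x₀) (𝓝 0) := fun x₀ => by
    have hc : Continuous fun x => p α (g x - g x₀) :=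
      (hp.continuous_seminorm α).comp (hgc.sub continuous_const)
    simpa using hc.tendsto x₀
  have hcont : Continuous h := continuous_iff_continuousAt.2 fun x₀ =>
    tendsto_iff_norm_sub_tendsto_zero.2
      (squeeze_zero (fun _ => norm_nonneg _) (fun x => h2 x x₀) (hsub x₀))
  have hmul : ∀ (c : 𝕜) j x, ‖c‖ ≤ p α (g x) → ‖c‖ * ν j x ≤ p α (g x) * ν j x :=
    fun c j x hc => mul_le_mul_of_nonneg_right hc (ν j x).2
  have hmem : (⟨h, hcont⟩ : C(Ω, 𝕜)) ∈ weightedSubmodule₀ ν (scalarSeminorms 𝕜) :=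
    mem_weightedSubmodule₀_iff.2 fun j _ => by
      refine ⟨⟨seminorms ν p (j, α) g, fun x =>
        (hmul _ j x (h1 x)).trans (apply_mul_le_seminorms g j α x)⟩, fun ε hε => ?_⟩
      obtain ⟨K, hK, hgK⟩ := exists_isCompact_apply_mul_le g j α hε
      exact ⟨K, hK, fun x hx => (hmul _ j x (h1 x)).trans (hgK x hx)⟩
  refine ⟨mk _ hmem, ⟨h1, h2⟩, ?_⟩
  have ht : Tendsto id (U : Filter (CVZeroScalar 𝕜 ν)) (𝓝 (mk _ hmem)) := by
    rw [(withSeminorms ν (scalarSeminorms 𝕜)).tendsto_nhds]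
    rintro ⟨j, -⟩ ε hε
    obtain ⟨L, hL, hgL⟩ := exists_isCompact_apply_mul_le g j α (ε := ε / 4) (by positivity)
    obtain ⟨C, hC⟩ := hbdd L hL j
    -- Chosen so that `3 δ (C + 1) = 3 ε / 4`; `C + 1` avoids division by zero.
    set δ := ε / (4 * (C + 1)) with hδ
    have hδ0 : 0 < δ := by positivity
    obtain ⟨s, -, hs⟩ := hL.elim_nhds_subcover (fun x₀ => {x | p α (g x - g x₀) < δ})
      fun x₀ _ => (hsub x₀).eventually_lt_const hδ0
    have hev : ∀ᶠ f in (U : Filter (CVZeroScalar 𝕜 ν)), ∀ y ∈ s, ‖f y - h y‖ < δ :=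
      s.eventually_all.2 fun y _ =>
        (tendsto_iff_norm_sub_tendsto_zero.1 (hh y)).eventually_lt_const hδ0
    filter_upwards [hev, hU] with f hf hfU
    refine lt_of_le_of_lt ((seminorms_le_iff (M := 3 * (ε / 4)) (by positivity)).2
      fun x => ?_) (by linarith)
    change ‖f x - h x‖ * ν j x ≤ _
    by_cases hx : x ∈ L
    · obtain ⟨y, hy, hxy⟩ := mem_iUnion₂.1 (hs hx)
      have hxy' : p α (g x - g y) < δ := hxy
      have h3 : ‖f x - h x‖ ≤ 3 * δ := by
        have e : f x - h x = (f x - f y) + (f y - h y) - (h x - h y) := by ring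
        rw [e]
        refine (norm_sub_le _ _).trans ?_
        have := norm_add_le (f x - f y) (f y - h y)
        have := hfU.2 x y
        have := h2 x y
        have := hf y hy
        linarith
      calc ‖f x - h x‖ * ν j x ≤ 3 * δ * (C + 1) := by
            have : (ν j x : ℝ) ≤ C := hC x hx
            gcongr
            linarith
        _ = 3 * (ε / 4) := by
            rw [hδ]
            field_simp
    · have h3 := hmul _ j x (hfU.1 x)
      have h4 := hmul _ j x (h1 x)
      have h5 := hgL x hx
      calc ‖f x - h x‖ * ν j x ≤ (‖f x‖ + ‖h x‖) * ν j x := by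
            gcongr
            exact norm_sub_le _ _
        _ ≤ 3 * (ε / 4) := by
            rw [add_mul]
            linarith
  exact ht

end CVZero

/-! ### The isomorphisms for complete `E`: statement (c) -/

section

open CVZero

variable {𝕜 Ω E J A : Type*} [RCLike 𝕜] [TopologicalSpace Ω] [T2Space Ω] [LocallyCompactSpace Ω]
  [AddCommGroup E] [Module 𝕜 E] [UniformSpace E] [IsUniformAddGroup E]
  [ContinuousSMul 𝕜 E] {p : SeminormFamily 𝕜 E A} {ν : J → Ω → ℝ≥0}

/-- The map `CV⁰₀(Ω) ⊗ E → CV⁰₀(Ω, E)`, `∑ fₙ ⊗ eₙ ↦ (x ↦ ∑ fₙ(x) eₙ)`. -/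
noncomputable def tensorEval (hp : WithSeminorms p) (hν : IsWeightFamily ν)
    (haway : IsLocallyBoundedAwayFromZero ν) :
    InjTensor 𝕜 (CVZeroScalar 𝕜 ν) E →ₗ[𝕜] CVZero ν p :=
  epsEval hp hν haway ∘ₗ InjTensor.theta 𝕜

theorem isInducing_tensorEval (hp : WithSeminorms p) (hν : IsWeightFamily ν)
    (hbdd : IsLocallyBoundedFamily ν) (haway : IsLocallyBoundedAwayFromZero ν) :
    IsInducing (tensorEval hp hν haway) :=
  (isInducing_epsEval hp hν hbdd haway).comp (InjTensor.isUniformInducing_theta 𝕜).isInducing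

theorem exists_tensorEval_eq_tensorFun (hp : WithSeminorms p) (hν : IsWeightFamily ν)
    (hbdd : IsLocallyBoundedFamily ν) (haway : IsLocallyBoundedAwayFromZero ν)
    (t : C_c(Ω, 𝕜) ⊗[𝕜] E) :
    ∃ s, toContinuousMap ν p (tensorEval hp hν haway s) = tensorFun t := by
  induction t with
  | zero => exact ⟨0, by simp⟩
  | tmul φ e =>
    refine ⟨(CVZero.mk φ.toContinuousMap (mem_weightedSubmodule₀_of_hasCompactSupport
      (withSeminorms_scalarSeminorms 𝕜).continuous_seminorm hbdd φ.hasCompactSupport) :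
        CVZeroScalar 𝕜 ν) ⊗ₜ[𝕜] e, ?_⟩
    ext x
    rw [tensorFun_tmul_apply]
    change thetaMap 𝕜 (_ ⊗ₜ[𝕜] e) (evalDelta 𝕜 hν x) = _
    rw [thetaMap, TensorProduct.lift.tmul]
    rfl
  | add t₁ t₂ h₁ h₂ =>
    obtain ⟨s₁, h₁⟩ := h₁
    obtain ⟨s₂, h₂⟩ := h₂
    exact ⟨s₁ + s₂, by rw [map_add, map_add, map_add, h₁, h₂]⟩

theorem denseRange_tensorEval (hp : WithSeminorms p) (hν : IsWeightFamily ν)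
    (hbdd : IsLocallyBoundedFamily ν) (haway : IsLocallyBoundedAwayFromZero ν) :
    DenseRange (tensorEval hp hν haway) := by
  refine (dense_tensorFun hp hbdd).mono ?_
  rintro f ⟨t, ht⟩
  obtain ⟨s, hs⟩ := exists_tensorEval_eq_tensorFun hp hν hbdd haway t
  exact ⟨s, CVZero.ext fun x => by rw [hs, ht]⟩

variable [T2Space E] [CompleteSpace E]

/-- The preimage of `g` is `y ↦ G y g`, where `G y` extends `t ↦ Θ(t)(y)` continuously to `CV⁰₀(Ω,
E)`. Identities between the `G y` need checking on tensors only. -/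
theorem surjective_epsEval (hp : WithSeminorms p) (hν : IsWeightFamily ν)
    (hbdd : IsLocallyBoundedFamily ν) (haway : IsLocallyBoundedAwayFromZero ν) :
    Function.Surjective (epsEval hp hν haway) := by
  intro g
  have hd := denseRange_tensorEval hp hν hbdd haway
  let ev : KappaDual 𝕜 (CVZeroScalar 𝕜 ν) → InjTensor 𝕜 (CVZeroScalar 𝕜 ν) E →L[𝕜] E := fun y =>
    { toFun := fun t => InjTensor.theta 𝕜 t y
      map_add' := fun s t => by
        rw [map_add]
        rfl
      map_smul' := fun c t => by
        rw [map_smul]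
        rfl
      cont := (continuous_eval_epsProduct y).comp
        (InjTensor.isUniformInducing_theta 𝕜).isInducing.continuous }
  choose G hG using fun y => exists_continuousLinearMap_extension
    (isInducing_tensorEval hp hν hbdd haway) hd (ev y)
  -- The transpose identity passes from tensors to all `g` by density.
  have hpair : ∀ y (e : E →L[𝕜] 𝕜) (α : A) (he : ∀ v, ‖e v‖ ≤ p α v) (g : CVZero ν p),
      e (G y g) = y (compScalar e α he g) := fun y e α he => congrFun <|
    hd.equalizer (e.continuous.comp (G y).continuous)
      ((map_continuous y).comp (continuous_compScalar e α he)) <| funext fun t =>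
        (congrArg e (hG y t)).trans
          (apply_eq_apply_compScalar_epsEval hp hν hbdd haway (InjTensor.theta 𝕜 t) y e α he)
  have hadd : ∀ y z, G (y + z) g = G y g + G z g := fun y z => congrFun
    (hd.equalizer (G (y + z)).continuous ((G y).continuous.add (G z).continuous) <|
      funext fun t => by
        change G (y + z) _ = G y _ + G z _
        rw [hG, hG, hG]
        exact map_add (InjTensor.theta 𝕜 t) y z) g
  have hsmul : ∀ (c : 𝕜) y, G (c • y) g = c • G y g := fun c y => congrFun
    (hd.equalizer (G (c • y)).continuous ((G y).continuous.const_smul c) <|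
      funext fun t => by
        change G (c • y) _ = c • G y _
        rw [hG, hG]
        exact map_smul (InjTensor.theta 𝕜 t) c y) g
  let u : KappaDual 𝕜 (CVZeroScalar 𝕜 ν) →ₗ[𝕜] E :=
    { toFun := fun y => G y g, map_add' := hadd, map_smul' := hsmul }
  -- A norming functional `e` gives `p_α(u(y)) = |y(e ∘ g)|`, and `e ∘ g` stays in a fixed compact
  -- set whatever `e` is.
  have hu : Continuous u := continuous_of_absConvexCompact_le hp u fun α =>
    ⟨dominatedSet g α, ⟨isAbsolutelyConvex_dominatedSet g α, isCompact_dominatedSet hp hbdd g α⟩,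
      fun y t _ hy => by
        obtain ⟨e, he, heq⟩ := hp.exists_strongDual_apply_eq α (u y)
        have h1 : p α (u y) = ‖e (u y)‖ := by
          rw [heq, RCLike.norm_ofReal, abs_of_nonneg (apply_nonneg _ _)]
        have h2 : e (u y) = y (compScalar e α he g) := hpair y e α he g
        rw [h1, h2]
        exact hy _ (compScalar_mem_dominatedSet g α e he)⟩
  refine ⟨UniformConvergenceCLM.ofFun (RingHom.id 𝕜) E
    (equicontinuousSets 𝕜 (CVZeroScalar 𝕜 ν)) ⟨u, hu⟩, CVZero.ext fun x => ?_⟩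
  exact congrFun (hd.equalizer (G (evalDelta 𝕜 hν x)).continuous (continuous_eval hp hν x)
    (funext fun t => hG _ t)) g

/-- The isomorphism `CV⁰₀(Ω) ε E ≅ CV⁰₀(Ω, E)`. -/
theorem exists_epsProduct_equiv (hp : WithSeminorms p) (hν : IsWeightFamily ν)
    (hbdd : IsLocallyBoundedFamily ν) (haway : IsLocallyBoundedAwayFromZero ν) :
    ∃ S : EpsProduct 𝕜 (CVZeroScalar 𝕜 ν) E ≃L[𝕜] CVZero ν p,
      ∀ u, S u = epsEval hp hν haway u := by
  have := t2Space_epsProduct (𝕜 := 𝕜) (X := CVZeroScalar 𝕜 ν) (E := E)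
  have hi := isInducing_epsEval hp hν hbdd haway
  let S := LinearEquiv.ofBijective (epsEval hp hν haway)
    ⟨hi.injective, surjective_epsEval hp hν hbdd haway⟩
  let S' := S.toEquiv.toHomeomorphOfIsInducing hi
  exact ⟨{ S with
    continuous_toFun := S'.continuous
    continuous_invFun := S'.symm.continuous }, fun _ => rfl⟩

/-- The isomorphism of `CV⁰₀(Ω) ε E` with the completed injective tensor product. -/
theorem exists_completedInjTensor_equiv (hp : WithSeminorms p) (hν : IsWeightFamily ν)
    (hbdd : IsLocallyBoundedFamily ν) (haway : IsLocallyBoundedAwayFromZero ν) :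
    ∃ T : EpsProduct 𝕜 (CVZeroScalar 𝕜 ν) E ≃L[𝕜] CompletedInjTensor 𝕜 (CVZeroScalar 𝕜 ν) E,
      ∀ t : InjTensor 𝕜 (CVZeroScalar 𝕜 ν) E, T (InjTensor.theta 𝕜 t) = t := by
  have := t2Space_epsProduct (𝕜 := 𝕜) (X := CVZeroScalar 𝕜 ν) (E := E)
  obtain ⟨S, hS⟩ := exists_epsProduct_equiv hp hν hbdd haway
  -- Completeness is transported along `S` from `CV⁰₀(Ω, E)`.
  have : CompleteSpace (EpsProduct 𝕜 (CVZeroScalar 𝕜 ν) E) := by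
    let : UniformSpace (CVZero ν p) := IsTopologicalAddGroup.rightUniformSpace _
    have : IsUniformAddGroup (CVZero ν p) := isUniformAddGroup_of_addCommGroup
    have hS' : IsUniformInducing S :=
      AddMonoidHom.isUniformInducing_of_isInducing S.toHomeomorph.isInducing
    exact (hS'.completeSpace_congr S.surjective).2 (CVZero.completeSpace hp haway)
  refine exists_continuousLinearEquiv_completion (InjTensor.isUniformInducing_theta 𝕜) ?_
  have h := S.symm.surjective.denseRange.comp (denseRange_tensorEval hp hν hbdd haway)
    S.symm.continuous
  have heq : S.symm ∘ tensorEval hp hν haway = InjTensor.theta 𝕜 := funext fun t => by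
    change S.symm (epsEval hp hν haway (InjTensor.theta 𝕜 t)) = _
    rw [← hS, S.symm_apply_apply]
  rwa [heq] at h

end

theorem mainTheorem2 {𝕜 Ω E J A : Type*} [RCLike 𝕜]
    [TopologicalSpace Ω] [T2Space Ω] [LocallyCompactSpace Ω]
    [AddCommGroup E] [Module 𝕜 E] [UniformSpace E] [IsUniformAddGroup E] [ContinuousSMul 𝕜 E]
    [T2Space E] (p : SeminormFamily 𝕜 E A) (hp : WithSeminorms p)
    (ν : J → Ω → ℝ≥0) (hν : IsWeightFamily ν)
    (hbdd : IsLocallyBoundedFamily ν) (haway : IsLocallyBoundedAwayFromZero ν) :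
    -- a) the tensors lie in the weighted space and are dense there
    ((∀ t : C_c(Ω, 𝕜) ⊗[𝕜] E, tensorFun t ∈ weightedSubmodule₀ ν p) ∧
      Dense {f : CVZero ν p | ∃ t : C_c(Ω, 𝕜) ⊗[𝕜] E,
        CVZero.toContinuousMap ν p f = tensorFun t}) ∧
    -- b) approximation with supports
    (∀ f : C(Ω, E), HasCompactSupport f → ∀ V : Set Ω, IsOpen V → tsupport f ⊆ V →
      ∀ ε : ℝ, 0 < ε → ∀ (j : J) (α : A), ∃ g : C_c(Ω, 𝕜) ⊗[𝕜] E,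
        tsupport (tensorFun g) ⊆ V ∧
          weightedSup (p α) (ν j) Set.univ (f - tensorFun g) ≤ ENNReal.ofReal ε) ∧
    -- c) the isomorphisms for complete `E`
    (CompleteSpace E →
      (∃ S : EpsProduct 𝕜 (CVZeroScalar 𝕜 ν) E ≃L[𝕜] CVZero ν p,
        ∀ u x, S u x = u (evalDelta 𝕜 hν x)) ∧
      (∃ T : EpsProduct 𝕜 (CVZeroScalar 𝕜 ν) E ≃L[𝕜]
          CompletedInjTensor 𝕜 (CVZeroScalar 𝕜 ν) E,
        ∀ t : InjTensor 𝕜 (CVZeroScalar 𝕜 ν) E, T (InjTensor.theta 𝕜 t) = t)) ∧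
    -- d) the approximation property
    HasApproximationProperty 𝕜 (CVZeroScalar 𝕜 ν) := by
  refine ⟨⟨tensorFun_mem_weightedSubmodule₀ hp hbdd, dense_tensorFun hp hbdd⟩,
    exists_tensorFun_tsupport_subset hp hbdd, fun _ => ⟨?_, ?_⟩,
    hasApproximationProperty_cvZeroScalar hν hbdd haway⟩
  · obtain ⟨S, hS⟩ := exists_epsProduct_equiv hp hν hbdd haway
    exact ⟨S, fun u x => by rw [hS, epsEval_apply]⟩
  · exact exists_completedInjTensor_equiv hp hν hbdd haway
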